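/- For real numbers $\alpha$ and $X\ge 1$ let $$S_d(\alpha;X)=\sum_{1\le n\le X} d(n)\,e^{2\pi i n\alpha},$$ where $d(n)=\sum_{m\mid n}1$ is the number of positive divisors of $n$. Then for every real $s$ with $0<s<1$, $$\int_0^1|S_d(\alpha;X)|^s\,d\alpha\gg_s X^{s/2}\qquad (X\ge 1);$$ that is, for every $s\in(0,1)$ there is a constant $C>0$, depending only on $s$, such that $X^{s/2}\le C\int_0^1|S_d(\alpha;X)|^s\,d\alpha$ for all real $X\ge 1$. -/

import Mathlib

/-- The additive character `e(x) = exp(2πix)`. -/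
noncomputable def addChar (x : ℝ) : ℂ :=
  Complex.exp (2 * (Real.pi : ℂ) * Complex.I * (x : ℂ))

/-- The exponential sum `S_d(α; X) = ∑_{n ≤ X} d(n) e(nα)`, where `n` runs over the positive
integers up to the real number `X` and `d(n)` is the number of positive divisors of `n`. -/
noncomputable def divisorExpSum (α X : ℝ) : ℂ :=
  ∑ n ∈ Finset.Icc 1 ⌊X⌋₊, (n.divisors.card : ℂ) * addChar ((n : ℝ) * α)

/-!
The moment is bounded below by showing that the sum has size at least a constant times `√X` on a set
of `α` of positive measure.

Let `M = ⌊X⌋`, `N = ⌊√M⌋` and `Q = ⌊N / D⌋` for a large constant `D`. The points considered are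
`α = r / q + β` with `q ≤ Q`, `(r, q) = 1` and `|β| ≤ 1 / (16M)`; there are at least `Q² / 16`
fractions (`sq_le_sum_totient`), and the arcs around them are disjoint. Writing
`d(n) = ∑_{a ∣ n} w(a, n)` by a smooth hyperbola method, with `w` supported on `a < 2N` and piecewise
linear in `n` (`card_divisors_eq_sum_divisorWeight`), and detecting `a ∣ n` by additive characters,
one gets an exact expansion of the sum over all fractions `r' / q'` with `q' ≤ 2N`
(`sum_dvd_eq_sum_frac`). The term `r' / q' = r / q` contributes at least `M / (8q)`, which is
`≫ D √X` (`le_norm_sum_smoothWeight`). The other fractions contribute less in mean square over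
the points, without loss of logarithms.

For that, denominators are split into dyadic blocks `q' ∈ [R, 2R)`, and the jumps of the weights at
the ends `0` and `M` are removed by ramps of length `QR`. The remaining weights have trigonometric
kernels bounded by the inverse square of the distance to the nearest integer, by two summations by
parts (`norm_sum_mul_addChar_le`); as `r / q + β` and `r' / q'` are at distance at least `1 / (4QR)`,
Schur's test applies (`sum_sq_offDiag_le`). The ramps live on windows of length `QR`, where the large
sieve and its dual apply (`bilinear_large_sieve`). Both give a mean square that decays geometrically
as `R` decreases from `2N` (`sum_sq_blockError_le`), so the total over the points is
`≪ Q N³` (`sum_sq_totalError_le`). Relative to the `≍ Q²` points the mean square is `≪ D N²`, against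
`≫ D² N²` for the main term, and Chebyshev's inequality finishes the argument
(`card_large_values_ge`). Bounded `X` are covered by a neighbourhood of `α = 0`
(`moment_ge_of_small`).
-/

open Finset

/-! ### The additive character and the distance to the nearest integer -/

lemma addChar_add (x y : ℝ) : addChar (x + y) = addChar x * addChar y := by
  simp only [addChar, ← Complex.exp_add]
  congr 1
  push_cast
  ring

lemma norm_addChar (x : ℝ) : ‖addChar x‖ = 1 := by
  have : addChar x = Complex.exp ((2 * Real.pi * x : ℝ) * Complex.I) := by
    unfold addChar
    congr 1
    push_cast
    ring
  rw [this, Complex.norm_exp_ofReal_mul_I]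

lemma addChar_nat_mul (n : ℕ) (x : ℝ) : addChar (n * x) = addChar x ^ n := by
  simp only [addChar, ← Complex.exp_nat_mul]
  congr 1
  push_cast
  ring

lemma addChar_int (m : ℤ) : addChar m = 1 := by
  rw [addChar, Complex.exp_eq_one_iff]
  exact ⟨m, by push_cast; ring⟩

lemma addChar_neg (x : ℝ) : addChar (-x) = starRingEnd ℂ (addChar x) := by
  simp only [addChar, ← Complex.exp_conj]
  congr 1
  rw [map_mul, map_mul, map_mul, Complex.conj_I, Complex.conj_ofReal, Complex.conj_ofReal, map_ofNat]
  push_cast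
  ring

lemma re_addChar (x : ℝ) : (addChar x).re = Real.cos (2 * Real.pi * x) := by
  have : addChar x = Complex.exp ((2 * Real.pi * x : ℝ) * Complex.I) := by
    unfold addChar
    congr 1
    push_cast
    ring
  rw [this, Complex.exp_ofReal_mul_I_re]

lemma continuous_addChar : Continuous addChar := by
  unfold addChar
  fun_prop

/-- The distance from a real number to the nearest integer. -/
noncomputable def distInt (x : ℝ) : ℝ := |x - round x|

lemma distInt_nonneg (x : ℝ) : 0 ≤ distInt x := abs_nonneg _

lemma distInt_le_abs_sub (x : ℝ) (m : ℤ) : distInt x ≤ |x - m| := round_le x m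

lemma distInt_neg (x : ℝ) : distInt (-x) = distInt x := by
  apply le_antisymm
  · refine (distInt_le_abs_sub (-x) (-round x)).trans_eq ?_
    rw [distInt, ← abs_neg]
    congr 1
    push_cast
    ring
  · refine (distInt_le_abs_sub x (-round (-x))).trans_eq ?_
    rw [distInt, ← abs_neg]
    congr 1
    push_cast
    ring

lemma distInt_sub_comm (x y : ℝ) : distInt (x - y) = distInt (y - x) := by
  rw [← distInt_neg, neg_sub]

lemma distInt_add_le (x y : ℝ) : distInt (x + y) ≤ distInt x + |y| := by
  refine (distInt_le_abs_sub (x + y) (round x)).trans ?_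
  rw [distInt, add_sub_right_comm]
  exact abs_add_le _ _

lemma four_mul_distInt_le (x : ℝ) : 4 * distInt x ≤ ‖1 - addChar x‖ := by
  have h1 : addChar x = addChar (x - round x) := by
    have := addChar_add (x - round x) (round x : ℤ)
    rwa [addChar_int, mul_one, sub_add_cancel] at this
  have h2 : |x - round x| ≤ 1 / 2 := abs_sub_round x
  rw [distInt, h1]
  set t := x - round x
  have h3 : addChar t = Complex.exp (Complex.I * (2 * Real.pi * t : ℝ)) := by
    unfold addChar
    congr 1
    push_cast
    ring
  rw [h3, norm_sub_rev, Complex.norm_exp_I_mul_ofReal_sub_one, Real.norm_eq_abs, abs_mul,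
    abs_of_pos (by norm_num : (0 : ℝ) < 2)]
  have h4 : 2 * Real.pi * t / 2 = Real.pi * t := by ring
  have h5 : |Real.pi * t| ≤ Real.pi / 2 := by
    rw [abs_mul, abs_of_pos Real.pi_pos]
    nlinarith [Real.pi_pos]
  have h6 := Real.mul_abs_le_abs_sin h5
  rw [h4]
  have h7 : 2 / Real.pi * |Real.pi * t| = 2 * |t| := by
    rw [abs_mul, abs_of_pos Real.pi_pos]
    field_simp
  linarith

/-! ### Sums of inverse squares over well-spaced points -/

lemma sum_range_inv_sq_le {γ δ : ℝ} (hγ : 0 < γ) (hδ : 0 < δ) (B : ℕ) :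
    ∑ m ∈ range B, 1 / (γ + m * δ) ^ 2 ≤ 1 / γ ^ 2 + 1 / (γ * δ) := by
  suffices h : ∀ B : ℕ, ∑ m ∈ range (B + 1), 1 / (γ + m * δ) ^ 2 ≤
      1 / γ ^ 2 + 1 / (γ * δ) - 1 / (δ * (γ + B * δ)) by
    cases B with
    | zero => simp; positivity
    | succ B =>
      refine (h B).trans ?_
      have : 0 ≤ 1 / (δ * (γ + B * δ)) := by positivity
      linarith
  intro B
  induction B with
  | zero => simp [mul_comm]
  | succ B ih =>
    rw [sum_range_succ]
    have hp : 0 < γ + B * δ := by positivity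
    have key : 1 / (γ + (B + 1 : ℕ) * δ) ^ 2 ≤
        1 / (δ * (γ + B * δ)) - 1 / (δ * (γ + (B + 1 : ℕ) * δ)) := by
      have e : γ + (B + 1 : ℕ) * δ = (γ + B * δ) + δ := by push_cast; ring
      rw [e]
      set p := γ + B * δ
      have e2 : 1 / (δ * p) - 1 / (δ * (p + δ)) = 1 / (p * (p + δ)) := by
        field_simp
        ring
      rw [e2]
      apply one_div_le_one_div_of_le (by positivity)
      nlinarith
    linarith

/-- The points `t j` lie in distinct cells `[mδ, (m + 1)δ)`, which compares the sum with one over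
`m`. -/
lemma sum_inv_sq_le_of_spaced_pos {ι : Type*} (J : Finset ι) (t : ι → ℝ) {γ δ : ℝ}
    (hγ : 0 < γ) (hδ : 0 < δ) (ht : ∀ j ∈ J, γ ≤ t j)
    (hs : ∀ i ∈ J, ∀ j ∈ J, i ≠ j → δ ≤ |t i - t j|) :
    ∑ j ∈ J, 1 / t j ^ 2 ≤ 4 * (1 / γ ^ 2 + 1 / (γ * δ)) := by
  classical
  set m : ι → ℕ := fun j => ⌊t j / δ⌋₊
  have hm : ∀ j ∈ J, m j * δ ≤ t j ∧ t j < (m j + 1) * δ := by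
    intro j hj
    have h0 : 0 ≤ t j / δ := div_nonneg (hγ.le.trans (ht j hj)) hδ.le
    exact ⟨(le_div_iff₀ hδ).1 (Nat.floor_le h0), (div_lt_iff₀ hδ).1 (Nat.lt_floor_add_one _)⟩
  have hinj : Set.InjOn m J := by
    intro i hi j hj hij
    by_contra hne
    have h1 := hs i hi j hj hne
    have h2 := hm i hi
    have h3 := hm j hj
    rw [hij] at h2
    have : |t i - t j| < δ := by rw [abs_lt]; constructor <;> nlinarith
    linarith
  calc ∑ j ∈ J, 1 / t j ^ 2 ≤ ∑ j ∈ J, 4 * (1 / (γ + m j * δ) ^ 2) := by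
        refine sum_le_sum fun j hj => ?_
        have h1 := hm j hj
        have h2 := ht j hj
        have h3 : 0 < γ + m j * δ := by positivity
        have h4 : 4 * (1 / (γ + m j * δ) ^ 2) = 1 / ((γ + m j * δ) / 2) ^ 2 := by
          field_simp
          norm_num
        rw [h4]
        apply one_div_le_one_div_of_le (by positivity)
        apply pow_le_pow_left₀ (by positivity)
        linarith
    _ = 4 * ∑ n ∈ J.image m, 1 / (γ + n * δ) ^ 2 := by
        rw [sum_image hinj, mul_sum]
    _ ≤ 4 * (1 / γ ^ 2 + 1 / (γ * δ)) := by
        gcongr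
        refine le_trans ?_ (sum_range_inv_sq_le hγ hδ ((J.image m).sup id + 1))
        refine sum_le_sum_of_subset_of_nonneg ?_ fun _ _ _ => by positivity
        intro n hn
        rw [mem_range]
        exact Nat.lt_succ_of_le (le_sup (f := id) hn)

lemma sum_inv_distInt_sq_le {ι : Type*} (J : Finset ι) (y : ι → ℝ) (x : ℝ) {γ δ : ℝ}
    (hγ : 0 < γ) (hδ : 0 < δ) (hx : ∀ j ∈ J, γ ≤ distInt (x - y j))
    (hs : ∀ i ∈ J, ∀ j ∈ J, i ≠ j → δ ≤ distInt (y i - y j)) :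
    ∑ j ∈ J, 1 / distInt (x - y j) ^ 2 ≤ 8 * (1 / γ ^ 2 + 1 / (γ * δ)) := by
  set t : ι → ℝ := fun j => x - y j - round (x - y j) with ht
  have habs : ∀ j, distInt (x - y j) = |t j| := fun j => rfl
  have hsp : ∀ i ∈ J, ∀ j ∈ J, i ≠ j → δ ≤ |t i - t j| := by
    intro i hi j hj hij
    refine (hs i hi j hj hij).trans ?_
    refine (distInt_le_abs_sub _ (round (x - y j) - round (x - y i))).trans_eq ?_
    rw [← abs_neg]
    congr 1
    simp only [ht]
    push_cast
    ring
  rw [← sum_filter_add_sum_filter_not J (fun j => 0 ≤ t j)]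
  have h1 : ∑ j ∈ J with 0 ≤ t j, 1 / distInt (x - y j) ^ 2 ≤
      4 * (1 / γ ^ 2 + 1 / (γ * δ)) := by
    simp only [habs, sq_abs]
    refine sum_inv_sq_le_of_spaced_pos _ t hγ hδ ?_ ?_
    · intro j hj
      rw [mem_filter] at hj
      rw [← abs_of_nonneg hj.2]
      exact hx j hj.1
    · intro i hi j hj
      exact hsp i (mem_filter.1 hi).1 j (mem_filter.1 hj).1
  have h2 : ∑ j ∈ J with ¬ 0 ≤ t j, 1 / distInt (x - y j) ^ 2 ≤
      4 * (1 / γ ^ 2 + 1 / (γ * δ)) := by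
    have e : ∀ j, 1 / distInt (x - y j) ^ 2 = 1 / (-t j) ^ 2 := fun j => by
      rw [habs, sq_abs, neg_sq]
    simp only [e]
    refine sum_inv_sq_le_of_spaced_pos _ (fun j => -t j) hγ hδ ?_ ?_
    · intro j hj
      rw [mem_filter, not_le] at hj
      have := hx j hj.1
      rwa [habs, abs_of_neg hj.2] at this
    · intro i hi j hj hij
      rw [neg_sub_neg, abs_sub_comm]
      exact hsp i (mem_filter.1 hi).1 j (mem_filter.1 hj).1 hij
  linarith

/-! ### Trigonometric sums with weights of small slope variation -/

/-- The slope variation of a sequence on `[0, M]`: the size of its first and last increments plus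
the total variation of its increments. -/
noncomputable def slopeVar (v : ℕ → ℝ) (M : ℕ) : ℝ :=
  |v 1 - v 0| + |v M - v (M - 1)| + ∑ n ∈ range (M - 1), |v (n + 2) - 2 * v (n + 1) + v n|

lemma slopeVar_nonneg (v : ℕ → ℝ) (M : ℕ) : 0 ≤ slopeVar v M := by
  unfold slopeVar
  positivity

lemma slopeVar_add_le (v w : ℕ → ℝ) (M : ℕ) :
    slopeVar (fun n => v n + w n) M ≤ slopeVar v M + slopeVar w M := by
  have h : ∀ a b c d e f : ℝ,
      |a + d - 2 * (b + e) + (c + f)| ≤ |a - 2 * b + c| + |d - 2 * e + f| := fun a b c d e f => by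
    rw [show a + d - 2 * (b + e) + (c + f) = (a - 2 * b + c) + (d - 2 * e + f) by ring]
    exact abs_add_le _ _
  have h' : ∀ a b c d : ℝ, |a + c - (b + d)| ≤ |a - b| + |c - d| := fun a b c d => by
    rw [show a + c - (b + d) = (a - b) + (c - d) by ring]
    exact abs_add_le _ _
  have h3 := sum_le_sum (s := range (M - 1)) fun n _ =>
    h (v (n + 2)) (v (n + 1)) (v n) (w (n + 2)) (w (n + 1)) (w n)
  rw [sum_add_distrib] at h3
  unfold slopeVar
  linarith [h' (v 1) (v 0) (w 1) (w 0), h' (v M) (v (M - 1)) (w M) (w (M - 1))]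

lemma slopeVar_const_mul (c : ℝ) (v : ℕ → ℝ) (M : ℕ) :
    slopeVar (fun n => c * v n) M = |c| * slopeVar v M := by
  have h : ∀ a b d : ℝ, |c * a - 2 * (c * b) + c * d| = |c| * |a - 2 * b + d| := fun a b d => by
    rw [← abs_mul]
    congr 1
    ring
  simp only [slopeVar, ← mul_sub, abs_mul, h, ← mul_sum]
  ring

lemma slopeVar_sum_le {ι : Type*} (G : Finset ι) (v : ι → ℕ → ℝ) (M : ℕ) :
    slopeVar (fun n => ∑ g ∈ G, v g n) M ≤ ∑ g ∈ G, slopeVar (v g) M := by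
  classical
  induction G using Finset.induction_on with
  | empty => simp [slopeVar]
  | insert g G hg ih =>
    simp only [sum_insert hg]
    exact (slopeVar_add_le _ _ M).trans (by linarith)

lemma slopeVar_const (c : ℝ) (M : ℕ) : slopeVar (fun _ => c) M = 0 := by
  simp only [slopeVar, sub_self, abs_zero, zero_add]
  exact sum_eq_zero fun n _ => by rw [abs_eq_zero]; ring

/-- A ramp is convex, so its increments are monotone and their total variation telescopes. -/
lemma slopeVar_ramp_le (c θ : ℝ) {M : ℕ} (hM : 1 ≤ M) :
    slopeVar (fun n => max 0 (c + θ * n)) M ≤ 4 * |θ| := by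
  obtain ⟨k, rfl⟩ := Nat.exists_eq_add_of_le' hM
  set f : ℕ → ℝ := fun n => max 0 (c + θ * n) with hf
  have hd : ∀ n, |f (n + 1) - f n| ≤ |θ| := by
    intro n
    refine (abs_max_sub_max_le_max 0 (c + θ * (n + 1 : ℕ)) 0 (c + θ * n)).trans ?_
    rw [sub_self, abs_zero, max_eq_right (abs_nonneg _)]
    apply le_of_eq
    congr 1
    push_cast
    ring
  have hconv : ∀ n, 0 ≤ f (n + 2) - 2 * f (n + 1) + f n := by
    intro n
    simp only [hf]
    push_cast
    have h1 := le_max_left 0 (c + θ * (n + 2))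
    have h2 := le_max_right 0 (c + θ * (n + 2))
    have h3 := le_max_left 0 (c + θ * n)
    have h4 := le_max_right 0 (c + θ * n)
    rcases max_cases 0 (c + θ * ((n : ℝ) + 1)) with h | h <;> rw [h.1] <;> linarith
  have hsum : ∑ n ∈ range k, |f (n + 2) - 2 * f (n + 1) + f n| = (f (k + 1) - f k) - (f 1 - f 0) := by
    rw [← sum_range_sub (fun n => f (n + 1) - f n) k]
    refine sum_congr rfl fun n _ => ?_
    rw [abs_of_nonneg (hconv n)]
    ring
  unfold slopeVar
  rw [Nat.add_sub_cancel, hsum]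
  have h1 := hd 0
  have h2 := hd k
  rw [zero_add] at h1
  have h3 := neg_abs_le (f 1 - f 0)
  have h4 := le_abs_self (f (k + 1) - f k)
  linarith

lemma one_sub_mul_sum (a : ℕ → ℂ) (z : ℂ) (k : ℕ) :
    (1 - z) * ∑ n ∈ range (k + 1), a n * z ^ n =
      a 0 - a k * z ^ (k + 1) + ∑ n ∈ range k, (a (n + 1) - a n) * z ^ (n + 1) := by
  induction k with
  | zero => simp; ring
  | succ k ih =>
    rw [sum_range_succ, mul_add, ih, sum_range_succ]
    ring

/-- Two summations by parts. -/
lemma sq_norm_one_sub_mul_norm_sum_le (v : ℕ → ℝ) {M : ℕ} (hM : 1 ≤ M) (h0 : v 0 = 0)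
    (hv : v M = 0) {z : ℂ} (hz : ‖z‖ = 1) :
    ‖1 - z‖ ^ 2 * ‖∑ n ∈ range (M + 1), (v n : ℂ) * z ^ n‖ ≤ slopeVar v M := by
  obtain ⟨k, rfl⟩ := Nat.exists_eq_add_of_le' hM
  have e1 := one_sub_mul_sum (fun n => (v n : ℂ)) z (k + 1)
  simp only [h0, hv] at e1
  have e2 := one_sub_mul_sum (fun n => ((v (n + 1) - v n : ℝ) : ℂ)) z k
  have e3 : (1 - z) ^ 2 * ∑ n ∈ range (k + 1 + 1), (v n : ℂ) * z ^ n =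
      z * ((1 - z) * ∑ n ∈ range (k + 1), ((v (n + 1) - v n : ℝ) : ℂ) * z ^ n) := by
    rw [sq, mul_assoc, e1, mul_left_comm, mul_sum _ _ z]
    congr 1
    simp only [Complex.ofReal_zero, zero_mul, sub_zero, zero_add]
    refine sum_congr rfl fun n _ => ?_
    push_cast
    ring
  rw [← norm_pow, ← norm_mul, e3, norm_mul, hz, one_mul, e2]
  refine (norm_add_le _ _).trans ?_
  unfold slopeVar
  rw [Nat.add_sub_cancel]
  refine add_le_add ?_ ?_
  · refine (norm_sub_le _ _).trans ?_
    rw [norm_mul, norm_pow, hz, one_pow, mul_one, Complex.norm_real, Complex.norm_real]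
    simp
  · refine (norm_sum_le _ _).trans (sum_le_sum fun n _ => ?_)
    rw [norm_mul, norm_pow, hz, one_pow, mul_one, ← Complex.ofReal_sub, Complex.norm_real,
      Real.norm_eq_abs]
    apply le_of_eq
    congr 1
    ring

lemma norm_sum_mul_addChar_le (v : ℕ → ℝ) {M : ℕ} (hM : 1 ≤ M) (h0 : v 0 = 0)
    (hv : v M = 0) {x : ℝ} (hx : 0 < distInt x) :
    ‖∑ n ∈ range (M + 1), (v n : ℂ) * addChar (n * x)‖ ≤
      slopeVar v M * (1 / distInt x ^ 2) / 16 := by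
  have h1 := sq_norm_one_sub_mul_norm_sum_le v hM h0 hv (norm_addChar x)
  simp only [← addChar_nat_mul] at h1
  have h2 := four_mul_distInt_le x
  set A := ‖∑ n ∈ range (M + 1), (v n : ℂ) * addChar (n * x)‖
  have h3 : (4 * distInt x) ^ 2 * A ≤ slopeVar v M :=
    le_trans (by gcongr) h1
  rw [mul_one_div, div_div, le_div_iff₀ (by positivity)]
  linarith

/-! ### The large sieve inequality -/

/-- The tent of half-width `2L` and height `2` centred at `2L`. -/
noncomputable def tent (L : ℕ) (n : ℕ) : ℝ := (n : ℝ) / L - 2 * max 0 (-2 + 1 / (L : ℝ) * n)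

lemma tent_eq (L n : ℕ) : tent L n = min ((n : ℝ) / L) (4 - n / L) := by
  unfold tent
  have e : -2 + 1 / (L : ℝ) * n = n / L - 2 := by ring
  rw [e]
  rcases le_total (n / L : ℝ) 2 with h | h
  · rw [max_eq_left (by linarith), min_eq_left (by linarith)]
    ring
  · rw [max_eq_right (by linarith), min_eq_right (by linarith)]
    ring

lemma slopeVar_tent_le {L M : ℕ} (hL : 1 ≤ L) (hM : 1 ≤ M) : slopeVar (tent L) M ≤ 12 / L := by
  have hL' : (0 : ℝ) < L := by exact_mod_cast hL
  have e : tent L = fun n : ℕ => max 0 (0 + 1 / (L : ℝ) * n) +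
      -2 * max 0 (-2 + 1 / (L : ℝ) * n) := by
    funext n
    have : max 0 (0 + 1 / (L : ℝ) * n) = n / L := by
      rw [zero_add, max_eq_right (by positivity)]
      ring
    rw [this]
    unfold tent
    ring
  rw [e]
  refine (slopeVar_add_le _ _ M).trans ?_
  rw [slopeVar_const_mul]
  have h1 := slopeVar_ramp_le 0 (1 / (L : ℝ)) hM
  have h2 := slopeVar_ramp_le (-2) (1 / (L : ℝ)) hM
  rw [abs_of_pos (by positivity)] at h1 h2
  rw [show |(-2 : ℝ)| = 2 by norm_num]
  have : 12 / (L : ℝ) = 4 * (1 / L) + 2 * (4 * (1 / L)) := by ring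
  linarith

/-- Schur's bound for Hermitian forms, with the entries controlled by their absolute values. -/
lemma norm_sum_sum_mul_le {ι : Type*} (J : Finset ι) (c : ι → ℂ) (K : ι → ι → ℂ) {B : ℝ}
    (hsymm : ∀ i j, ‖K i j‖ = ‖K j i‖) (hB : ∀ i ∈ J, ∑ j ∈ J, ‖K i j‖ ≤ B) :
    ‖∑ i ∈ J, ∑ j ∈ J, c i * starRingEnd ℂ (c j) * K i j‖ ≤ B * ∑ i ∈ J, ‖c i‖ ^ 2 := by
  have h1 : ‖∑ i ∈ J, ∑ j ∈ J, c i * starRingEnd ℂ (c j) * K i j‖ ≤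
      ∑ i ∈ J, ∑ j ∈ J, (‖c i‖ ^ 2 * ‖K i j‖ / 2 + ‖c j‖ ^ 2 * ‖K i j‖ / 2) := by
    refine (norm_sum_le _ _).trans (sum_le_sum fun i _ => ?_)
    refine (norm_sum_le _ _).trans (sum_le_sum fun j _ => ?_)
    rw [norm_mul, norm_mul, RCLike.norm_conj]
    nlinarith [mul_nonneg (sq_nonneg (‖c i‖ - ‖c j‖)) (norm_nonneg (K i j))]
  refine h1.trans ?_
  have h2 : ∑ i ∈ J, ∑ j ∈ J, ‖c j‖ ^ 2 * ‖K i j‖ / 2 =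
      ∑ i ∈ J, ∑ j ∈ J, ‖c i‖ ^ 2 * ‖K i j‖ / 2 := by
    rw [sum_comm]
    exact sum_congr rfl fun i _ => sum_congr rfl fun j _ => by rw [hsymm]
  simp only [sum_add_distrib]
  rw [h2, ← two_mul, mul_sum, mul_sum]
  refine sum_le_sum fun i hi => ?_
  rw [← sum_div, ← mul_sum]
  have := mul_le_mul_of_nonneg_left (hB i hi) (sq_nonneg ‖c i‖)
  linarith

/-- The dual large sieve inequality: `L` is at least the number of frequencies and at least the
reciprocal of the spacing of the points. The frequencies are majorized by a tent. -/
lemma dual_large_sieve {ι : Type*} (J : Finset ι) (y : ι → ℝ) (c : ι → ℂ) {δ : ℝ} {L H : ℕ}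
    (hδ : 0 < δ) (hL : 1 ≤ L) (hHL : H ≤ L) (hδL : 1 ≤ L * δ)
    (hs : ∀ i ∈ J, ∀ j ∈ J, i ≠ j → δ ≤ distInt (y i - y j)) (n₀ : ℕ) :
    ∑ n ∈ Ico n₀ (n₀ + H), ‖∑ j ∈ J, c j * addChar (n * y j)‖ ^ 2 ≤
      40 * L * ∑ j ∈ J, ‖c j‖ ^ 2 := by
  classical
  have hL' : (0 : ℝ) < L := by exact_mod_cast hL
  have hM : 1 ≤ 4 * L := by omega
  have htent : ∀ n ∈ range (4 * L + 1), 0 ≤ tent L n ∧ tent L n ≤ 2 := by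
    intro n hn
    rw [tent_eq]
    have h1 : (n : ℝ) / L ≤ 4 := by
      rw [div_le_iff₀ hL']
      exact_mod_cast Nat.lt_succ_iff.1 (mem_range.1 hn)
    have h2 : (0 : ℝ) ≤ (n : ℝ) / L := by positivity
    refine ⟨le_min h2 (by linarith), ?_⟩
    rcases le_total ((n : ℝ) / L) 2 with h | h
    · exact (min_le_left _ _).trans h
    · exact (min_le_right _ _).trans (by linarith)
  have ht0 : tent L 0 = 0 := by simp [tent]
  have ht4 : tent L (4 * L) = 0 := by
    rw [tent_eq]
    push_cast
    rw [mul_div_assoc, div_self hL'.ne']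
    norm_num
  -- The window is moved to the plateau `[2L, 3L]` of the tent, the phases absorbed in `c`.
  set c' : ι → ℂ := fun j => c j * addChar (((n₀ : ℝ) - 2 * L) * y j) with hc'
  have hc'n : ∀ j, ‖c' j‖ = ‖c j‖ := fun j => by rw [hc', norm_mul, norm_addChar, mul_one]
  set F : ℕ → ℂ := fun m => ∑ j ∈ J, c' j * addChar (m * y j) with hF
  have hshift : ∀ t : ℕ, ∑ j ∈ J, c j * addChar ((n₀ + t : ℕ) * y j) = F (2 * L + t) := by
    intro t
    refine sum_congr rfl fun j _ => ?_
    rw [hc', mul_assoc, ← addChar_add]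
    congr 2
    push_cast
    ring
  have h1 : ∑ n ∈ Ico n₀ (n₀ + H), ‖∑ j ∈ J, c j * addChar (n * y j)‖ ^ 2 ≤
      ∑ m ∈ range (4 * L + 1), tent L m * ‖F m‖ ^ 2 := by
    rw [sum_Ico_eq_sum_range, Nat.add_sub_cancel_left]
    simp only [hshift]
    have e : ∑ t ∈ range H, ‖F (2 * L + t)‖ ^ 2 = ∑ m ∈ Ico (2 * L) (2 * L + H), ‖F m‖ ^ 2 := by
      rw [sum_Ico_eq_sum_range, Nat.add_sub_cancel_left]
    rw [e]
    refine le_trans (sum_le_sum fun m hm => ?_)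
      (sum_le_sum_of_subset_of_nonneg (f := fun m => tent L m * ‖F m‖ ^ 2) ?_ ?_)
    · rw [mem_Ico] at hm
      have : 1 ≤ tent L m := by
        rw [tent_eq]
        have a1 : (2 * L : ℝ) ≤ m := by exact_mod_cast hm.1
        have a2 : (m : ℝ) ≤ 3 * L := by
          have : m ≤ 3 * L := by omega
          exact_mod_cast this
        apply le_min
        · rw [le_div_iff₀ hL']
          linarith
        · rw [le_sub_comm, div_le_iff₀ hL']
          linarith
      exact le_mul_of_one_le_left (by positivity) this
    · intro m hm
      rw [mem_Ico] at hm
      rw [mem_range]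
      omega
    · intro m hm _
      exact mul_nonneg (htent m hm).1 (by positivity)
  refine h1.trans ?_
  set K : ι → ι → ℂ := fun i j =>
    ∑ m ∈ range (4 * L + 1), (tent L m : ℂ) * addChar (m * (y i - y j)) with hK
  have h2 : ((∑ m ∈ range (4 * L + 1), tent L m * ‖F m‖ ^ 2 : ℝ) : ℂ) =
      ∑ i ∈ J, ∑ j ∈ J, c' i * starRingEnd ℂ (c' j) * K i j := by
    rw [Complex.ofReal_sum]
    simp only [hK, mul_sum]
    rw [sum_congr rfl fun i _ => sum_comm, sum_comm]
    refine sum_congr rfl fun m _ => ?_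
    have : ((‖F m‖ ^ 2 : ℝ) : ℂ) = F m * starRingEnd ℂ (F m) := by
      rw [Complex.mul_conj, Complex.normSq_eq_norm_sq]
    rw [Complex.ofReal_mul, this, hF, map_sum, sum_mul_sum, mul_sum]
    refine sum_congr rfl fun i _ => ?_
    rw [mul_sum]
    refine sum_congr rfl fun j _ => ?_
    rw [map_mul, ← addChar_neg, mul_sub, sub_eq_add_neg, addChar_add]
    ring
  have h3 : ∑ m ∈ range (4 * L + 1), tent L m * ‖F m‖ ^ 2 =
      ‖∑ i ∈ J, ∑ j ∈ J, c' i * starRingEnd ℂ (c' j) * K i j‖ := by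
    rw [← h2, Complex.norm_real, Real.norm_eq_abs, abs_of_nonneg]
    exact sum_nonneg fun m hm => mul_nonneg (htent m hm).1 (by positivity)
  rw [h3]
  simp only [← hc'n]
  apply norm_sum_sum_mul_le
  · intro i j
    have : K j i = starRingEnd ℂ (K i j) := by
      simp only [hK, map_sum, map_mul, Complex.conj_ofReal, ← addChar_neg]
      refine sum_congr rfl fun m _ => ?_
      congr 2
      ring
    rw [this, RCLike.norm_conj]
  · intro i hi
    rw [← add_sum_erase J _ hi]
    have hdiag : ‖K i i‖ ≤ 10 * L := by
      refine (norm_sum_le _ _).trans ?_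
      calc ∑ m ∈ range (4 * L + 1), ‖(tent L m : ℂ) * addChar (m * (y i - y i))‖
          ≤ ∑ m ∈ range (4 * L + 1), (2 : ℝ) := by
            refine sum_le_sum fun m hm => ?_
            rw [norm_mul, norm_addChar, mul_one, Complex.norm_real, Real.norm_eq_abs,
              abs_of_nonneg (htent m hm).1]
            exact (htent m hm).2
        _ ≤ 10 * L := by
            rw [sum_const, card_range, nsmul_eq_mul]
            push_cast
            have : (1 : ℝ) ≤ L := by exact_mod_cast hL
            linarith
    have hoff : ∑ j ∈ J.erase i, ‖K i j‖ ≤ 30 * L := by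
      calc ∑ j ∈ J.erase i, ‖K i j‖
          ≤ ∑ j ∈ J.erase i, 12 / L / 16 * (1 / distInt (y i - y j) ^ 2) := by
            refine sum_le_sum fun j hj => ?_
            rw [mem_erase] at hj
            have hp : 0 < distInt (y i - y j) := hδ.trans_le (hs i hi j hj.2 hj.1.symm)
            refine (norm_sum_mul_addChar_le (tent L) hM ht0 ht4 hp).trans ?_
            have := slopeVar_tent_le hL hM
            rw [mul_div_right_comm]
            gcongr
        _ ≤ 12 / L / 16 * (8 * (1 / δ ^ 2 + 1 / (δ * δ))) := by
            rw [← mul_sum]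
            refine mul_le_mul_of_nonneg_left ?_ (by positivity)
            refine sum_inv_distInt_sq_le _ y _ hδ hδ ?_ ?_
            · intro j hj
              rw [mem_erase] at hj
              exact hs i hi j hj.2 hj.1.symm
            · intro a ha b hb
              exact hs a (mem_of_mem_erase ha) b (mem_of_mem_erase hb)
        _ ≤ 30 * L := by
            have e : 12 / (L : ℝ) / 16 * (8 * (1 / δ ^ 2 + 1 / (δ * δ))) = 12 / (L * δ ^ 2) := by
              field_simp
              norm_num
            rw [e, div_le_iff₀ (by positivity)]
            nlinarith
    linarith

/-- The large sieve inequality, from its dual form. -/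
lemma large_sieve {ι : Type*} (I : Finset ι) (x : ι → ℝ) (b : ℕ → ℂ) {δ : ℝ} {L H : ℕ}
    (hδ : 0 < δ) (hL : 1 ≤ L) (hHL : H ≤ L) (hδL : 1 ≤ L * δ)
    (hs : ∀ i ∈ I, ∀ j ∈ I, i ≠ j → δ ≤ distInt (x i - x j)) (n₀ : ℕ) :
    ∑ i ∈ I, ‖∑ n ∈ Ico n₀ (n₀ + H), b n * addChar (n * x i)‖ ^ 2 ≤
      40 * L * ∑ n ∈ Ico n₀ (n₀ + H), ‖b n‖ ^ 2 := by
  set W := Ico n₀ (n₀ + H)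
  set F : ι → ℂ := fun i => ∑ n ∈ W, b n * addChar (n * x i) with hF
  set T := ∑ i ∈ I, ‖F i‖ ^ 2 with hT
  have hT0 : 0 ≤ T := by positivity
  have h1 := dual_large_sieve I x (fun i => starRingEnd ℂ (F i)) hδ hL hHL hδL hs n₀
  simp only [RCLike.norm_conj] at h1
  set G : ℕ → ℂ := fun n => ∑ i ∈ I, starRingEnd ℂ (F i) * addChar (n * x i) with hG
  have h2 : (T : ℂ) = ∑ n ∈ W, b n * G n := by
    simp only [hT, hG, mul_sum, Complex.ofReal_sum]
    rw [sum_comm]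
    refine sum_congr rfl fun i _ => ?_
    have : ((‖F i‖ ^ 2 : ℝ) : ℂ) = F i * starRingEnd ℂ (F i) := by
      rw [Complex.mul_conj, Complex.normSq_eq_norm_sq]
    rw [this]
    nth_rewrite 1 [hF]
    rw [sum_mul]
    exact sum_congr rfl fun n _ => by ring
  have h3 : T ≤ ∑ n ∈ W, ‖b n‖ * ‖G n‖ := by
    have : T = ‖(T : ℂ)‖ := by rw [Complex.norm_real, Real.norm_eq_abs, abs_of_nonneg hT0]
    rw [this, h2]
    refine (norm_sum_le _ _).trans_eq ?_
    simp
  have h4 : T ^ 2 ≤ (∑ n ∈ W, ‖b n‖ ^ 2) * (40 * L * T) :=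
    calc T ^ 2 ≤ (∑ n ∈ W, ‖b n‖ * ‖G n‖) ^ 2 := by gcongr
      _ ≤ (∑ n ∈ W, ‖b n‖ ^ 2) * ∑ n ∈ W, ‖G n‖ ^ 2 := sum_mul_sq_le_sq_mul_sq _ _ _
      _ ≤ _ := by gcongr
  rcases hT0.eq_or_lt with h | h
  · rw [← h]
    positivity
  · nlinarith

/-- A weighted trigonometric kernel on a window of length `H` is a bounded bilinear form between
two well-spaced sets of points: the large sieve and its dual are applied in turn. -/
lemma bilinear_large_sieve {ι κ : Type*} (I : Finset ι) (x : ι → ℝ) (J : Finset κ) (y : κ → ℝ)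
    (c : κ → ℂ) (ω : ℕ → ℝ) {δ₁ δ₂ : ℝ} {L₁ L₂ H : ℕ} (n₀ : ℕ)
    (hω : ∀ n ∈ Ico n₀ (n₀ + H), |ω n| ≤ 1)
    (hδ₁ : 0 < δ₁) (hL₁ : 1 ≤ L₁) (hHL₁ : H ≤ L₁) (hδL₁ : 1 ≤ L₁ * δ₁)
    (hx : ∀ i ∈ I, ∀ j ∈ I, i ≠ j → δ₁ ≤ distInt (x i - x j))
    (hδ₂ : 0 < δ₂) (hL₂ : 1 ≤ L₂) (hHL₂ : H ≤ L₂) (hδL₂ : 1 ≤ L₂ * δ₂)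
    (hy : ∀ i ∈ J, ∀ j ∈ J, i ≠ j → δ₂ ≤ distInt (y i - y j)) :
    ∑ i ∈ I, ‖∑ j ∈ J, c j * ∑ n ∈ Ico n₀ (n₀ + H), (ω n : ℂ) * addChar (n * (x i - y j))‖ ^ 2 ≤
      1600 * L₁ * L₂ * ∑ j ∈ J, ‖c j‖ ^ 2 := by
  set b : ℕ → ℂ := fun n => ω n * ∑ j ∈ J, c j * addChar (n * -y j) with hb
  have h1 := large_sieve I x b hδ₁ hL₁ hHL₁ hδL₁ hx n₀
  have h2 := dual_large_sieve J (fun j => -y j) c hδ₂ hL₂ hHL₂ hδL₂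
    (fun i hi j hj hij => by rw [neg_sub_neg]; exact hy j hj i hi hij.symm) n₀
  have h3 : ∀ i, ∑ j ∈ J, c j * ∑ n ∈ Ico n₀ (n₀ + H), (ω n : ℂ) * addChar (n * (x i - y j)) =
      ∑ n ∈ Ico n₀ (n₀ + H), b n * addChar (n * x i) := by
    intro i
    simp only [hb, mul_sum, sum_mul]
    rw [sum_comm]
    refine sum_congr rfl fun n _ => sum_congr rfl fun j _ => ?_
    rw [sub_eq_add_neg, mul_add, addChar_add]
    ring
  simp only [h3]
  have h4 : ∑ n ∈ Ico n₀ (n₀ + H), ‖b n‖ ^ 2 ≤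
      ∑ n ∈ Ico n₀ (n₀ + H), ‖∑ j ∈ J, c j * addChar (n * -y j)‖ ^ 2 := by
    refine sum_le_sum fun n hn => ?_
    rw [hb, norm_mul, Complex.norm_real, Real.norm_eq_abs]
    gcongr
    exact mul_le_of_le_one_left (norm_nonneg _) (hω n hn)
  calc _ ≤ 40 * (L₁ : ℝ) * ∑ n ∈ Ico n₀ (n₀ + H), ‖b n‖ ^ 2 := h1
    _ ≤ 40 * (L₁ : ℝ) * (40 * L₂ * ∑ j ∈ J, ‖c j‖ ^ 2) := by gcongr; exact h4.trans h2
    _ = _ := by ring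

/-- Schur's test for a matrix with two well-spaced sets of points and entries bounded by the
inverse square of the distance. -/
lemma sum_sq_offDiag_le {ι : Type*} [DecidableEq ι] (I J : Finset ι) (x y : ι → ℝ)
    (K : ι → ι → ℂ) {A γ δ₁ δ₂ : ℝ} (hA : 0 ≤ A) (hγ : 0 < γ) (hδ₁ : 0 < δ₁) (hδ₂ : 0 < δ₂)
    (hK : ∀ i ∈ I, ∀ j ∈ J, i ≠ j → ‖K i j‖ ≤ A * (1 / distInt (x i - y j) ^ 2))
    (hxy : ∀ i ∈ I, ∀ j ∈ J, i ≠ j → γ ≤ distInt (x i - y j))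
    (hx : ∀ i ∈ I, ∀ j ∈ I, i ≠ j → δ₁ ≤ distInt (x i - x j))
    (hy : ∀ i ∈ J, ∀ j ∈ J, i ≠ j → δ₂ ≤ distInt (y i - y j)) :
    ∑ i ∈ I, ‖∑ j ∈ J.erase i, K i j‖ ^ 2 ≤
      #J * (A * (8 * (1 / γ ^ 2 + 1 / (γ * δ₁)))) * (A * (8 * (1 / γ ^ 2 + 1 / (γ * δ₂)))) := by
  set R := A * (8 * (1 / γ ^ 2 + 1 / (γ * δ₂)))
  have hR : 0 ≤ R := by positivity
  have hrow : ∀ i ∈ I, ∑ j ∈ J.erase i, ‖K i j‖ ≤ R := by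
    intro i hi
    calc ∑ j ∈ J.erase i, ‖K i j‖ ≤ ∑ j ∈ J.erase i, A * (1 / distInt (x i - y j) ^ 2) :=
          sum_le_sum fun j hj => hK i hi j (mem_of_mem_erase hj) (ne_of_mem_erase hj).symm
      _ ≤ R := by
          rw [← mul_sum]
          refine mul_le_mul_of_nonneg_left (sum_inv_distInt_sq_le _ y _ hγ hδ₂ ?_ ?_) hA
          · exact fun j hj => hxy i hi j (mem_of_mem_erase hj) (ne_of_mem_erase hj).symm
          · exact fun a ha b hb => hy a (mem_of_mem_erase ha) b (mem_of_mem_erase hb)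
  have hcol : ∀ j ∈ J, ∑ i ∈ I.erase j, ‖K i j‖ ≤ A * (8 * (1 / γ ^ 2 + 1 / (γ * δ₁))) := by
    intro j hj
    calc ∑ i ∈ I.erase j, ‖K i j‖ ≤ ∑ i ∈ I.erase j, A * (1 / distInt (y j - x i) ^ 2) := by
          refine sum_le_sum fun i hi => ?_
          rw [distInt_sub_comm]
          exact hK i (mem_of_mem_erase hi) j hj (ne_of_mem_erase hi)
      _ ≤ _ := by
          rw [← mul_sum]
          refine mul_le_mul_of_nonneg_left (sum_inv_distInt_sq_le _ x _ hγ hδ₁ ?_ ?_) hA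
          · intro i hi
            rw [distInt_sub_comm]
            exact hxy i (mem_of_mem_erase hi) j hj (ne_of_mem_erase hi)
          · exact fun a ha b hb => hx a (mem_of_mem_erase ha) b (mem_of_mem_erase hb)
  calc ∑ i ∈ I, ‖∑ j ∈ J.erase i, K i j‖ ^ 2
      ≤ ∑ i ∈ I, R * ∑ j ∈ J.erase i, ‖K i j‖ := by
        refine sum_le_sum fun i hi => ?_
        have h1 := norm_sum_le (J.erase i) (K i)
        have h2 := hrow i hi
        rw [sq]
        exact mul_le_mul (h1.trans h2) h1 (norm_nonneg _) hR
    _ = R * ∑ j ∈ J, ∑ i ∈ I.erase j, ‖K i j‖ := by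
        rw [← mul_sum]
        congr 1
        refine sum_comm' fun i j => ?_
        simp only [mem_erase]
        constructor
        · rintro ⟨h1, h2, h3⟩
          exact ⟨⟨h2.symm, h1⟩, h3⟩
        · rintro ⟨⟨h1, h2⟩, h3⟩
          exact ⟨h2, h1.symm, h3⟩
    _ ≤ R * ∑ j ∈ J, A * (8 * (1 / γ ^ 2 + 1 / (γ * δ₁))) := by
        gcongr with j hj
        exact hcol j hj
    _ = _ := by
        rw [sum_const, nsmul_eq_mul]
        ring

/-! ### Farey fractions and divisor sums -/

/-- The reduced fractions `r / q` in `[0, 1)` with denominator `q ∈ A`, encoded as pairs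
`⟨q, r⟩`. -/
def fareyPairs (A : Finset ℕ) : Finset ((_ : ℕ) × ℕ) :=
  A.sigma fun q => (range q).filter q.Coprime

/-- The fraction `r / q` encoded by the pair `⟨q, r⟩`. -/
noncomputable def frac (p : (_ : ℕ) × ℕ) : ℝ := (p.2 : ℝ) / p.1

lemma mem_fareyPairs {A : Finset ℕ} {p : (_ : ℕ) × ℕ} :
    p ∈ fareyPairs A ↔ p.1 ∈ A ∧ p.2 < p.1 ∧ p.1.Coprime p.2 := by
  simp [fareyPairs]

lemma card_fareyPairs (A : Finset ℕ) : #(fareyPairs A) = ∑ q ∈ A, q.totient := by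
  rw [fareyPairs, card_sigma]
  rfl

/-- Distinct reduced fractions `r / q` and `r' / q'` are at distance at least `1 / (q q')`
modulo `1`. -/
lemma inv_mul_le_distInt_frac {A B : Finset ℕ} {p p' : (_ : ℕ) × ℕ} (hp : p ∈ fareyPairs A)
    (hp' : p' ∈ fareyPairs B) (hne : p ≠ p') :
    1 / ((p.1 : ℝ) * p'.1) ≤ distInt (frac p - frac p') := by
  obtain ⟨q, r⟩ := p
  obtain ⟨q', r'⟩ := p'
  obtain ⟨-, hr, hc⟩ := mem_fareyPairs.1 hp
  obtain ⟨-, hr', hc'⟩ := mem_fareyPairs.1 hp'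
  simp only [frac] at *
  have hq : (0 : ℝ) < q := by exact_mod_cast (Nat.zero_le r).trans_lt hr
  have hq' : (0 : ℝ) < q' := by exact_mod_cast (Nat.zero_le r').trans_lt hr'
  rw [distInt]
  set m := round ((r : ℝ) / q - r' / q')
  have e : (r : ℝ) / q - r' / q' - m = ((r * q' - r' * q - m * q * q' : ℤ) : ℝ) / (q * q') := by
    push_cast
    field_simp
  rw [e, abs_div, abs_of_pos (mul_pos hq hq')]
  gcongr
  have hint : (r * q' - r' * q - m * q * q' : ℤ) ≠ 0 := by
    intro h0
    have hqz : (0 : ℤ) < q := by exact_mod_cast hq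
    have hqz' : (0 : ℤ) < q' := by exact_mod_cast hq'
    have hm : m = 0 := by
      have hrz : (r : ℤ) < q := by exact_mod_cast hr
      have hrz' : (r' : ℤ) < q' := by exact_mod_cast hr'
      have h1 : m * (q * q') = r * q' - r' * q := by linarith
      have hr0 : (0 : ℤ) ≤ r := by positivity
      have hr0' : (0 : ℤ) ≤ r' := by positivity
      have hlt : m < 1 := by nlinarith [mul_pos hqz hqz', mul_nonneg hr0' hqz.le]
      have hgt : -1 < m := by nlinarith [mul_pos hqz hqz', mul_nonneg hr0 hqz'.le]
      omega
    rw [hm] at h0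
    have h1 : r * q' = r' * q := by
      have : (r * q' : ℤ) = r' * q := by linarith
      exact_mod_cast this
    have hd : q ∣ q' := hc.dvd_of_dvd_mul_left (h1 ▸ dvd_mul_left q r')
    have hd' : q' ∣ q := hc'.dvd_of_dvd_mul_left (h1 ▸ dvd_mul_left q' r)
    have hqq : q = q' := Nat.dvd_antisymm hd hd'
    subst hqq
    have : r = r' := Nat.eq_of_mul_eq_mul_right (by exact_mod_cast hq) h1
    exact hne (by rw [this])
  exact_mod_cast Int.one_le_abs hint

lemma sum_Icc_sum_divisors {E : Type*} [AddCommMonoid E] (B : ℕ) (f : ℕ → ℕ → E) :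
    ∑ a ∈ Icc 1 B, ∑ q ∈ a.divisors, f a q =
      ∑ q ∈ Icc 1 B, ∑ g ∈ Icc 1 (B / q), f (g * q) q := by
  rw [sum_sigma', sum_sigma']
  refine sum_bij' (fun p _ => ⟨p.2, p.1 / p.2⟩) (fun p _ => ⟨p.2 * p.1, p.1⟩) ?_ ?_ ?_ ?_ ?_
  · rintro ⟨a, q⟩ h
    simp only [mem_sigma, mem_Icc, Nat.mem_divisors] at h ⊢
    obtain ⟨⟨h1, h2⟩, h3, -⟩ := h
    have hq : 0 < q := Nat.pos_of_dvd_of_pos h3 h1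
    exact ⟨⟨hq, (Nat.le_of_dvd h1 h3).trans h2⟩, Nat.div_pos (Nat.le_of_dvd h1 h3) hq,
      Nat.div_le_div_right h2⟩
  · rintro ⟨q, g⟩ h
    simp only [mem_sigma, mem_Icc, Nat.mem_divisors] at h ⊢
    obtain ⟨⟨h1, h2⟩, h3, h4⟩ := h
    exact ⟨⟨Nat.mul_pos h3 h1, (Nat.le_div_iff_mul_le h1).1 h4⟩, dvd_mul_left _ _,
      (Nat.mul_pos h3 h1).ne'⟩
  · rintro ⟨a, q⟩ h
    simp only [mem_sigma, mem_Icc, Nat.mem_divisors] at h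
    simp only [Nat.div_mul_cancel h.2.1]
  · rintro ⟨q, g⟩ h
    simp only [mem_sigma, mem_Icc] at h
    simp only [Nat.mul_div_cancel g h.1.1]
  · rintro ⟨a, q⟩ h
    simp only [mem_sigma, mem_Icc, Nat.mem_divisors] at h
    simp only [Nat.div_mul_cancel h.2.1]

lemma sum_range_div_eq_sum_reduced {E : Type*} [AddCommMonoid E] {a : ℕ} (ha : 0 < a)
    (F : ℝ → E) :
    ∑ k ∈ range a, F ((k : ℝ) / a) = ∑ q ∈ a.divisors, ∑ r ∈ range q with q.Coprime r,
      F ((r : ℝ) / q) := by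
  rw [sum_sigma']
  refine sum_bij' (fun k _ => ⟨a / a.gcd k, k / a.gcd k⟩) (fun p _ => p.2 * (a / p.1))
    ?_ ?_ ?_ ?_ ?_
  · intro k hk
    rw [mem_range] at hk
    have hg : 0 < a.gcd k := Nat.gcd_pos_of_pos_left k ha
    simp only [mem_sigma, Nat.mem_divisors, mem_filter, mem_range]
    exact ⟨⟨Nat.div_dvd_of_dvd (Nat.gcd_dvd_left a k), ha.ne'⟩,
      Nat.div_lt_div_of_lt_of_dvd (Nat.gcd_dvd_left a k) hk, Nat.coprime_div_gcd_div_gcd hg⟩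
  · rintro ⟨q, r⟩ h
    simp only [mem_sigma, Nat.mem_divisors, mem_filter, mem_range] at h ⊢
    obtain ⟨⟨⟨c, rfl⟩, -⟩, h2, -⟩ := h
    have hq : 0 < q := (Nat.zero_le r).trans_lt h2
    rw [Nat.mul_div_cancel_left c hq]
    exact Nat.mul_lt_mul_of_pos_right h2 (Nat.pos_of_mul_pos_left ha)
  · intro k hk
    have hg : 0 < a.gcd k := Nat.gcd_pos_of_pos_left k ha
    simp only
    rw [Nat.div_div_self (Nat.gcd_dvd_left a k) ha.ne',
      Nat.div_mul_cancel (Nat.gcd_dvd_right a k)]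
  · rintro ⟨q, r⟩ h
    simp only [mem_sigma, Nat.mem_divisors, mem_filter, mem_range] at h
    obtain ⟨⟨⟨c, rfl⟩, -⟩, h2, h3⟩ := h
    have hq : 0 < q := (Nat.zero_le r).trans_lt h2
    have hc : 0 < c := Nat.pos_of_mul_pos_left ha
    have hgcd : (q * c).gcd (r * c) = c := by
      rw [Nat.gcd_mul_right, h3.gcd_eq_one, one_mul]
    simp only [Nat.mul_div_cancel_left c hq, hgcd, Nat.mul_div_cancel _ hc]
  · intro k hk
    have hg : 0 < a.gcd k := Nat.gcd_pos_of_pos_left k ha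
    simp only
    rw [Nat.cast_div (Nat.gcd_dvd_left a k) (by positivity),
      Nat.cast_div (Nat.gcd_dvd_right a k) (by positivity),
      div_div_div_cancel_right₀ (by positivity)]

lemma sum_range_addChar {a : ℕ} (ha : 0 < a) (n : ℕ) :
    ∑ k ∈ range a, addChar (n * -((k : ℝ) / a)) = if a ∣ n then (a : ℂ) else 0 := by
  have ha' : (a : ℝ) ≠ 0 := by positivity
  have e : ∀ k : ℕ, addChar (n * -((k : ℝ) / a)) = addChar (-((n : ℝ) / a)) ^ k := by
    intro k
    rw [← addChar_nat_mul]
    congr 1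
    ring
  simp only [e]
  split_ifs with h
  · obtain ⟨c, rfl⟩ := h
    have : addChar (-(((a * c : ℕ) : ℝ) / a)) = 1 := by
      have h1 : -(((a * c : ℕ) : ℝ) / a) = ((-c : ℤ) : ℝ) := by
        push_cast
        field_simp
      rw [h1, addChar_int]
    simp only [this, one_pow, sum_const, card_range, nsmul_eq_mul, mul_one]
  · have hne : addChar (-((n : ℝ) / a)) ≠ 1 := by
      intro h1
      have h2 := four_mul_distInt_le (-((n : ℝ) / a))
      rw [h1, sub_self, norm_zero, distInt_neg] at h2
      have h3 : distInt ((n : ℝ) / a) = 0 := le_antisymm (by linarith) (distInt_nonneg _)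
      rw [distInt, abs_eq_zero, sub_eq_zero, div_eq_iff ha'] at h3
      have h4 : (n : ℤ) = round ((n : ℝ) / a) * a := by exact_mod_cast h3
      have h5 : (a : ℤ) ∣ n := h4 ▸ dvd_mul_left _ _
      exact h (by exact_mod_cast h5)
    rw [geom_sum_eq hne, ← addChar_nat_mul]
    have h1 : (a : ℝ) * -((n : ℝ) / a) = ((-n : ℤ) : ℝ) := by
      push_cast
      field_simp
    rw [h1, addChar_int, sub_self, zero_div]

/-- An exponential sum with coefficients `∑_{a ∣ n} w a n`, decomposed according to the fractions
`r / q`: the condition `a ∣ n` is detected by additive characters modulo `a`. -/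
lemma sum_dvd_eq_sum_frac (w : ℕ → ℕ → ℝ) (B M : ℕ) (x : ℝ) :
    ∑ n ∈ Icc 1 M, ((∑ a ∈ Icc 1 B with a ∣ n, w a n : ℝ) : ℂ) * addChar (n * x) =
      ∑ p ∈ fareyPairs (Icc 1 B), ∑ n ∈ Icc 1 M,
        ((∑ g ∈ Icc 1 (B / p.1), w (g * p.1) n / (g * p.1 : ℕ) : ℝ) : ℂ) *
          addChar (n * (x - frac p)) := by
  have h1 : ∀ n : ℕ, ((∑ a ∈ Icc 1 B with a ∣ n, w a n : ℝ) : ℂ) =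
      ∑ q ∈ Icc 1 B, ∑ g ∈ Icc 1 (B / q), ((w (g * q) n / (g * q : ℕ) : ℝ) : ℂ) *
        ∑ r ∈ range q with q.Coprime r, addChar (n * -((r : ℝ) / q)) := by
    intro n
    rw [← sum_Icc_sum_divisors B fun a q => ((w a n / a : ℝ) : ℂ) *
        ∑ r ∈ range q with q.Coprime r, addChar (n * -((r : ℝ) / q)), Complex.ofReal_sum,
      sum_filter]
    refine sum_congr rfl fun a ha => ?_
    have ha' : 0 < a := (mem_Icc.1 ha).1
    rw [← mul_sum, ← sum_range_div_eq_sum_reduced ha' fun t => addChar (n * -t),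
      sum_range_addChar ha']
    have : (a : ℂ) ≠ 0 := by exact_mod_cast ha'.ne'
    split_ifs
    · push_cast
      field_simp
    · rw [mul_zero]
  rw [fareyPairs, sum_sigma]
  simp only [h1, sum_mul, Complex.ofReal_sum, mul_sum, frac]
  rw [sum_comm]
  refine sum_congr rfl fun q _ => ?_
  symm
  rw [sum_comm]
  refine sum_congr rfl fun n _ => ?_
  rw [sum_comm]
  refine sum_congr rfl fun g _ => sum_congr rfl fun r _ => ?_
  rw [sub_eq_add_neg, mul_add, addChar_add]
  ring

/-- This lower bound for the totient summatory function follows from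
`∑_{q ≤ m} φ(q) ⌊m / q⌋ = m (m + 1) / 2`: the terms with `q ≤ m / 4` contribute at most `m² / 4`,
and the others at most `4 φ(q)` each. -/
lemma sq_le_sum_totient (m : ℕ) : (m : ℝ) ^ 2 / 16 ≤ ∑ q ∈ Icc 1 m, (q.totient : ℝ) := by
  have h1 : ∑ n ∈ Icc 1 m, (n : ℝ) = ∑ q ∈ Icc 1 m, (q.totient : ℝ) * (m / q : ℕ) := by
    have := sum_Icc_sum_divisors m fun _ q => (q.totient : ℝ)
    simp only [sum_const, Nat.card_Icc, Nat.add_sub_cancel, nsmul_eq_mul] at this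
    simp only [mul_comm (_ : ℝ) ((_ / _ : ℕ) : ℝ)]
    rw [← this]
    refine sum_congr rfl fun n _ => ?_
    rw [← Nat.cast_sum, Nat.sum_totient]
  have h2 : (m : ℝ) ^ 2 / 2 ≤ ∑ n ∈ Icc 1 m, (n : ℝ) := by
    clear h1
    induction m with
    | zero => simp
    | succ m ih =>
      rw [sum_Icc_succ_top (by omega)]
      push_cast
      nlinarith
  have h3 : ∀ q ∈ Icc 1 m, (q.totient : ℝ) * (m / q : ℕ) ≤
      4 * q.totient + if q ∈ Icc 1 (m / 4) then (m : ℝ) else 0 := by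
    intro q hq
    have hq1 : (0 : ℝ) < q := by exact_mod_cast (mem_Icc.1 hq).1
    have ht : (q.totient : ℝ) ≤ q := by exact_mod_cast Nat.totient_le q
    have hd : ((m / q : ℕ) : ℝ) ≤ m / q := Nat.cast_div_le
    split_ifs with h
    · have : (q.totient : ℝ) * (m / q : ℕ) ≤ q * (m / q) := by gcongr
      rw [mul_div_cancel₀ _ hq1.ne'] at this
      have h0 : (0 : ℝ) ≤ q.totient := by positivity
      linarith
    · rw [add_zero, mul_comm]
      gcongr
      have : m / q ≤ 4 := by
        rw [mem_Icc] at h hq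
        have : m < 4 * q + 4 := by omega
        have h4 : m / q < 5 + 0 := by
          rw [Nat.div_lt_iff_lt_mul (by omega)]
          by_contra hcon
          omega
        omega
      exact_mod_cast this
  have h4 := sum_le_sum h3
  rw [sum_add_distrib, ← mul_sum, ← h1, sum_ite_mem, sum_const, nsmul_eq_mul] at h4
  have h5 : (#(Icc 1 m ∩ Icc 1 (m / 4)) : ℝ) ≤ m / 4 := by
    calc (#(Icc 1 m ∩ Icc 1 (m / 4)) : ℝ) ≤ #(Icc 1 (m / 4)) := by
          exact_mod_cast card_le_card inter_subset_right
      _ ≤ m / 4 := by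
          rw [Nat.card_Icc, Nat.add_sub_cancel]
          exact Nat.cast_div_le
  have h6 : (#(Icc 1 m ∩ Icc 1 (m / 4)) : ℝ) * m ≤ m / 4 * m := by gcongr
  nlinarith

/-! ### A smooth divisor-switching identity -/

/-- The piecewise linear cutoff equal to `1` up to `N` and vanishing from `2N` on. -/
noncomputable def cutoff (N : ℕ) (t : ℝ) : ℝ := max 0 (2 - t / N) - max 0 (1 - t / N)

lemma cutoff_of_le {N : ℕ} (hN : 1 ≤ N) {t : ℝ} (ht : t ≤ N) : cutoff N t = 1 := by
  have hN' : (0 : ℝ) < N := by exact_mod_cast hN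
  have : t / N ≤ 1 := by rwa [div_le_one hN']
  rw [cutoff, max_eq_right (by linarith), max_eq_right (by linarith)]
  ring

lemma cutoff_of_ge {N : ℕ} (hN : 1 ≤ N) {t : ℝ} (ht : 2 * N ≤ t) : cutoff N t = 0 := by
  have hN' : (0 : ℝ) < N := by exact_mod_cast hN
  have : 2 ≤ t / N := by rwa [le_div_iff₀ hN']
  rw [cutoff, max_eq_left (by linarith), max_eq_left (by linarith), sub_zero]

lemma cutoff_nonneg (N : ℕ) (t : ℝ) : 0 ≤ cutoff N t := by
  rw [cutoff, sub_nonneg]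
  exact max_le_max le_rfl (by linarith)

lemma cutoff_le_one (N : ℕ) (t : ℝ) : cutoff N t ≤ 1 := by
  unfold cutoff
  rcases max_cases 0 (2 - t / (N : ℝ)) with h | h <;>
    rcases max_cases 0 (1 - t / (N : ℝ)) with h' | h' <;> rw [h.1, h'.1] <;> linarith

/-- The weight `u(a) (2 - u(n / a))` of the divisor `a` of `n`, where `u` is the cutoff. Summed over
the divisors of `n` it gives the same as `u(a) + u(n / a) - u(a) u(n / a)`; the asymmetric form is
supported on `a < 2N`. It is defined, and piecewise linear, for all `n`, not only multiples of `a`. -/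
noncomputable def divisorWeight (N a n : ℕ) : ℝ := cutoff N a * (2 - cutoff N ((n : ℝ) / a))

lemma cutoff_le_divisorWeight (N a n : ℕ) : cutoff N a ≤ divisorWeight N a n := by
  unfold divisorWeight
  nlinarith [cutoff_nonneg N a, cutoff_le_one N ((n : ℝ) / a)]

lemma divisorWeight_le (N a n : ℕ) : divisorWeight N a n ≤ 2 * cutoff N a := by
  unfold divisorWeight
  nlinarith [cutoff_nonneg N a, cutoff_nonneg N ((n : ℝ) / a)]

lemma divisorWeight_zero {N : ℕ} (hN : 1 ≤ N) (a : ℕ) : divisorWeight N a 0 = cutoff N a := by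
  have : cutoff N (((0 : ℕ) : ℝ) / a) = 1 := cutoff_of_le hN (by simp)
  rw [divisorWeight, this]
  ring

/-- The hyperbola method with a smooth cutoff: of two complementary divisors of `n < (N + 1) ^ 2`,
one is at most `N`. -/
lemma card_divisors_eq_sum_divisorWeight {N n : ℕ} (hN : 1 ≤ N) (hn : 1 ≤ n)
    (hnN : n < (N + 1) ^ 2) :
    (#n.divisors : ℝ) = ∑ a ∈ Icc 1 (2 * N) with a ∣ n, divisorWeight N a n := by
  have h1 : ∑ a ∈ Icc 1 (2 * N) with a ∣ n, divisorWeight N a n =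
      ∑ a ∈ n.divisors, divisorWeight N a n := by
    refine sum_subset ?_ ?_
    · intro a ha
      rw [mem_filter] at ha
      exact Nat.mem_divisors.2 ⟨ha.2, by omega⟩
    · intro a ha hna
      rw [Nat.mem_divisors] at ha
      have : 2 * N ≤ a := by
        by_contra hlt
        exact hna (mem_filter.2 ⟨mem_Icc.2 ⟨Nat.pos_of_dvd_of_pos ha.1 hn, by omega⟩, ha.1⟩)
      rw [divisorWeight, cutoff_of_ge hN (by exact_mod_cast this), zero_mul]
  have h2 : ∀ a ∈ n.divisors, ((n / a : ℕ) : ℝ) = (n : ℝ) / a := by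
    intro a ha
    have hd := Nat.dvd_of_mem_divisors ha
    have : (a : ℝ) ≠ 0 := by
      have := Nat.pos_of_dvd_of_pos hd hn
      positivity
    exact Nat.cast_div hd this
  have h3 : ∑ a ∈ n.divisors, cutoff N a = ∑ a ∈ n.divisors, cutoff N ((n : ℝ) / a) := by
    rw [← Nat.sum_div_divisors n fun a => cutoff N a]
    exact sum_congr rfl fun a ha => by rw [h2 a ha]
  have h4 : ∑ a ∈ n.divisors, divisorWeight N a n = ∑ a ∈ n.divisors, (cutoff N a +
      cutoff N ((n : ℝ) / a) - cutoff N a * cutoff N ((n : ℝ) / a)) := by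
    rw [sum_sub_distrib, sum_add_distrib, ← h3, ← sum_add_distrib, ← sum_sub_distrib]
    refine sum_congr rfl fun a _ => ?_
    rw [divisorWeight]
    ring
  rw [h1, h4, card_eq_sum_ones, Nat.cast_sum]
  refine sum_congr rfl fun a ha => ?_
  have hd := Nat.dvd_of_mem_divisors ha
  rcases le_or_gt a N with h | h
  · rw [cutoff_of_le hN (by exact_mod_cast h)]
    push_cast
    ring
  · have hb : n / a ≤ N := by
      have : n / a < N + 1 := by
        rw [Nat.div_lt_iff_lt_mul (by omega)]
        nlinarith
      omega
    rw [← h2 a ha, cutoff_of_le hN (t := ((n / a : ℕ) : ℝ)) (by exact_mod_cast hb)]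
    push_cast
    ring

lemma slopeVar_divisorWeight_le {N a M : ℕ} (hN : 1 ≤ N) (ha : 1 ≤ a) (hM : 1 ≤ M) :
    slopeVar (divisorWeight N a) M ≤ 8 / (a * N) := by
  have hN' : (0 : ℝ) < N := by exact_mod_cast hN
  have ha' : (0 : ℝ) < a := by exact_mod_cast ha
  set θ : ℝ := -(1 / (a * N)) with hθ
  have hθ' : |θ| = 1 / (a * N) := by rw [hθ, abs_neg, abs_of_pos (by positivity)]
  have e : divisorWeight N a = fun n : ℕ => cutoff N a *
      (2 + ((-1) * max 0 (2 + θ * n) + max 0 (1 + θ * n))) := by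
    funext n
    have h : (n : ℝ) / a / N = -(θ * n) := by
      rw [hθ]
      field_simp
    have hc : cutoff N ((n : ℝ) / a) = max 0 (2 + θ * n) - max 0 (1 + θ * n) := by
      rw [cutoff, h, sub_neg_eq_add, sub_neg_eq_add]
    rw [divisorWeight, hc]
    ring
  rw [e, slopeVar_const_mul, abs_of_nonneg (cutoff_nonneg N a)]
  have h1 := slopeVar_add_le (fun _ => 2)
    (fun n : ℕ => (-1) * max 0 (2 + θ * n) + max 0 (1 + θ * n)) M
  have h2 := slopeVar_add_le (fun n : ℕ => (-1) * max 0 (2 + θ * n)) (fun n : ℕ => max 0 (1 + θ * n)) M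
  rw [slopeVar_const_mul, abs_neg, abs_one, one_mul] at h2
  rw [slopeVar_const, zero_add] at h1
  have h3 := slopeVar_ramp_le 2 θ hM
  have h4 := slopeVar_ramp_le 1 θ hM
  refine (mul_le_of_le_one_left (slopeVar_nonneg _ _) (cutoff_le_one N a)).trans ?_
  have h5 : 8 / ((a : ℝ) * N) = 8 * |θ| := by rw [hθ']; ring
  linarith

/-! ### The weight of a fraction and its smooth part -/

/-- The total weight at `n` of the fractions with denominator `q`, collected from the divisors
`a = gq`. -/
noncomputable def fracWeight (N q n : ℕ) : ℝ :=
  ∑ g ∈ Icc 1 (2 * N / q), divisorWeight N (g * q) n / (g * q : ℕ)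

/-- The harmonic sum over the multiples of `q` up to `2N`, scaled by `q`. -/
noncomputable def harmonicTail (N q : ℕ) : ℝ := ∑ g ∈ Icc 1 (2 * N / q), 1 / (g : ℝ)

/-- The ramp descending from `1` at `0` to `0` at `H`. -/
noncomputable def headRamp (H n : ℕ) : ℝ := max 0 (1 + -(1 / (H : ℝ)) * n)

/-- The ramp ascending from `0` at `M - H` to `1` at `M`. -/
noncomputable def tailRamp (M H n : ℕ) : ℝ := max 0 (1 - (M : ℝ) / H + 1 / (H : ℝ) * n)

/-- The weight of a fraction on `[0, M]` with its jumps at both ends removed by ramps of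
length `H`. -/
noncomputable def smoothWeight (M N H q n : ℕ) : ℝ :=
  fracWeight N q n - fracWeight N q 0 * headRamp H n - fracWeight N q M * tailRamp M H n

lemma harmonicTail_nonneg (N q : ℕ) : 0 ≤ harmonicTail N q := by
  unfold harmonicTail
  positivity

lemma harmonicTail_anti (N : ℕ) {q q' : ℕ} (hq : 1 ≤ q) (h : q ≤ q') :
    harmonicTail N q' ≤ harmonicTail N q := by
  refine sum_le_sum_of_subset_of_nonneg ?_ fun _ _ _ => by positivity
  exact Icc_subset_Icc le_rfl (Nat.div_le_div_left h hq)

lemma fracWeight_nonneg (N q n : ℕ) : 0 ≤ fracWeight N q n :=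
  sum_nonneg fun _ _ => div_nonneg
    ((cutoff_nonneg N _).trans (cutoff_le_divisorWeight N _ n)) (Nat.cast_nonneg _)

lemma fracWeight_le (N q n : ℕ) : fracWeight N q n ≤ 2 * harmonicTail N q / q := by
  rw [fracWeight, harmonicTail, mul_sum, sum_div]
  refine sum_le_sum fun g _ => ?_
  have h : divisorWeight N (g * q) n ≤ 2 := by
    have h1 := divisorWeight_le N (g * q) n
    have h2 := cutoff_le_one N (g * q : ℕ)
    linarith
  have e : 2 * (1 / (g : ℝ)) / q = 2 / (g * q : ℕ) := by
    push_cast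
    rw [mul_one_div, div_div]
  rw [e]
  gcongr

lemma fracWeight_zero_le {N : ℕ} (hN : 1 ≤ N) (q n : ℕ) :
    fracWeight N q 0 ≤ fracWeight N q n := by
  refine sum_le_sum fun g _ => ?_
  rw [divisorWeight_zero hN]
  gcongr
  exact cutoff_le_divisorWeight _ _ _

lemma fracWeight_le_two_mul {N : ℕ} (hN : 1 ≤ N) (q n : ℕ) :
    fracWeight N q n ≤ 2 * fracWeight N q 0 := by
  rw [fracWeight, fracWeight, mul_sum]
  refine sum_le_sum fun g _ => ?_
  rw [divisorWeight_zero hN, ← mul_div_assoc]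
  gcongr
  exact divisorWeight_le _ _ _

lemma one_div_le_fracWeight_zero {N q : ℕ} (hq : 1 ≤ q) (hqN : q ≤ N) :
    1 / (q : ℝ) ≤ fracWeight N q 0 := by
  have hN : 1 ≤ N := hq.trans hqN
  have h1 : 1 ∈ Icc 1 (2 * N / q) :=
    mem_Icc.2 ⟨le_rfl, (Nat.one_le_div_iff hq).2 (by omega)⟩
  refine le_trans ?_ (single_le_sum (fun _ _ => ?_) h1)
  · rw [divisorWeight_zero hN, one_mul, cutoff_of_le hN (by exact_mod_cast hqN)]
  · rw [divisorWeight_zero hN]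
    exact div_nonneg (cutoff_nonneg _ _) (Nat.cast_nonneg _)

lemma headRamp_nonneg (H n : ℕ) : 0 ≤ headRamp H n := le_max_left _ _

lemma tailRamp_nonneg (M H n : ℕ) : 0 ≤ tailRamp M H n := le_max_left _ _

lemma headRamp_le_one (H n : ℕ) : headRamp H n ≤ 1 := by
  refine max_le zero_le_one ?_
  have : 0 ≤ 1 / (H : ℝ) * n := by positivity
  linarith

lemma tailRamp_le_one {M H n : ℕ} (hn : n ≤ M) : tailRamp M H n ≤ 1 := by
  refine max_le zero_le_one ?_
  have : 1 / (H : ℝ) * n ≤ 1 / (H : ℝ) * M := by gcongr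
  have e : 1 / (H : ℝ) * M = M / H := by ring
  linarith

lemma headRamp_of_ge {H n : ℕ} (hH : 1 ≤ H) (h : H ≤ n) : headRamp H n = 0 := by
  have hH' : (0 : ℝ) < H := by exact_mod_cast hH
  have h' : (H : ℝ) ≤ n := by exact_mod_cast h
  refine max_eq_left ?_
  have : 1 ≤ 1 / (H : ℝ) * n := by rwa [one_div_mul_eq_div, le_div_iff₀ hH', one_mul]
  linarith

lemma tailRamp_of_le {M H n : ℕ} (hH : 1 ≤ H) (h : n + H ≤ M) : tailRamp M H n = 0 := by
  have hH' : (0 : ℝ) < H := by exact_mod_cast hH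
  have h' : (n : ℝ) + H ≤ M := by exact_mod_cast h
  refine max_eq_left ?_
  have : 1 - (M : ℝ) / H + 1 / (H : ℝ) * n = (H + n - M) / H := by
    field_simp
    ring
  rw [this]
  exact div_nonpos_of_nonpos_of_nonneg (by linarith) hH'.le

lemma smoothWeight_zero {M H : ℕ} (N q : ℕ) (hH : 1 ≤ H) (hHM : H ≤ M) :
    smoothWeight M N H q 0 = 0 := by
  rw [smoothWeight, tailRamp_of_le hH (by omega)]
  simp [headRamp]

lemma smoothWeight_top {M H : ℕ} (N q : ℕ) (hH : 1 ≤ H) (hHM : H ≤ M) :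
    smoothWeight M N H q M = 0 := by
  have : tailRamp M H M = 1 := by
    have : 1 - (M : ℝ) / H + 1 / (H : ℝ) * M = 1 := by ring
    rw [tailRamp, this]
    simp
  rw [smoothWeight, headRamp_of_ge hH hHM, this]
  ring

lemma slopeVar_smoothWeight_le {M N H q : ℕ} (hN : 1 ≤ N) (hM : 1 ≤ M) (hq : 1 ≤ q) (hH : 1 ≤ H)
    (hHN : H ≤ q * N) :
    slopeVar (smoothWeight M N H q) M ≤ 24 * harmonicTail N q / (q * H) := by
  have hH' : (0 : ℝ) < H := by exact_mod_cast hH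
  have hq' : (0 : ℝ) < q := by exact_mod_cast hq
  set L := harmonicTail N q with hL
  have e : smoothWeight M N H q = fun n => fracWeight N q n +
      ((-fracWeight N q 0) * headRamp H n + (-fracWeight N q M) * tailRamp M H n) := by
    funext n
    rw [smoothWeight]
    ring
  have h1 : slopeVar (fracWeight N q) M ≤ 8 * L / (q * H) := by
    refine (slopeVar_sum_le _ (fun g n => divisorWeight N (g * q) n / (g * q : ℕ)) M).trans ?_
    rw [hL, harmonicTail, mul_sum, sum_div]
    refine sum_le_sum fun g hg => ?_
    have hg1 : 1 ≤ g := (mem_Icc.1 hg).1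
    have hg' : (1 : ℝ) ≤ g := by exact_mod_cast hg1
    have hgq : 1 ≤ g * q := Nat.mul_pos hg1 hq
    have e1 : slopeVar (fun n => divisorWeight N (g * q) n / (g * q : ℕ)) M =
        1 / (g * q : ℕ) * slopeVar (divisorWeight N (g * q)) M := by
      have := slopeVar_const_mul (1 / ((g * q : ℕ) : ℝ)) (divisorWeight N (g * q)) M
      rw [abs_of_nonneg (by positivity)] at this
      rw [← this]
      congr 1
      funext n
      ring
    rw [e1]
    calc 1 / ((g * q : ℕ) : ℝ) * slopeVar (divisorWeight N (g * q)) M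
        ≤ 1 / ((g * q : ℕ) : ℝ) * (8 / H) := by
          gcongr
          refine (slopeVar_divisorWeight_le hN hgq hM).trans ?_
          gcongr
          have : (H : ℝ) ≤ q * N := by exact_mod_cast hHN
          have h3 : (q * N : ℝ) ≤ g * (q * N) := le_mul_of_one_le_left (by positivity) hg'
          push_cast
          linarith
      _ = 8 * (1 / (g : ℝ)) / (q * H) := by
          push_cast
          field_simp
  have h2 : slopeVar (headRamp H) M ≤ 4 / H := by
    refine (slopeVar_ramp_le 1 (-(1 / (H : ℝ))) hM).trans_eq ?_
    rw [abs_neg, abs_of_pos (by positivity)]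
    ring
  have h3 : slopeVar (tailRamp M H) M ≤ 4 / H := by
    refine (slopeVar_ramp_le (1 - (M : ℝ) / H) (1 / (H : ℝ)) hM).trans_eq ?_
    rw [abs_of_pos (by positivity)]
    ring
  have h4 := fracWeight_le N q 0
  have h5 := fracWeight_le N q M
  rw [e]
  refine (slopeVar_add_le _ _ M).trans ?_
  have h6 := slopeVar_add_le (fun n => (-fracWeight N q 0) * headRamp H n)
    (fun n => (-fracWeight N q M) * tailRamp M H n) M
  rw [slopeVar_const_mul, slopeVar_const_mul, abs_neg, abs_neg,
    abs_of_nonneg (fracWeight_nonneg _ _ _), abs_of_nonneg (fracWeight_nonneg _ _ _)] at h6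
  have h7 : fracWeight N q 0 * slopeVar (headRamp H) M ≤ 2 * L / q * (4 / H) :=
    mul_le_mul h4 h2 (slopeVar_nonneg _ _) (by have := harmonicTail_nonneg N q; positivity)
  have h8 : fracWeight N q M * slopeVar (tailRamp M H) M ≤ 2 * L / q * (4 / H) :=
    mul_le_mul h5 h3 (slopeVar_nonneg _ _) (by have := harmonicTail_nonneg N q; positivity)
  have e9 : 24 * L / (q * H) = 8 * L / (q * H) + 2 * L / q * (4 / H) + 2 * L / q * (4 / H) := by
    field_simp
    ring
  linarith

lemma sum_headRamp_le {H : ℕ} (hH : 1 ≤ H) (M : ℕ) : ∑ n ∈ range (M + 1), headRamp H n ≤ H := by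
  calc ∑ n ∈ range (M + 1), headRamp H n
      ≤ ∑ n ∈ range (M + 1), if n ∈ range H then (1 : ℝ) else 0 := by
        refine sum_le_sum fun n _ => ?_
        split_ifs with h
        · exact headRamp_le_one H n
        · rw [mem_range, not_lt] at h
          exact (headRamp_of_ge hH h).le
    _ = #(range (M + 1) ∩ range H) := by rw [sum_ite_mem, sum_const, nsmul_one]
    _ ≤ H := by
        have := card_le_card (inter_subset_right (s₁ := range (M + 1)) (s₂ := range H))
        rw [card_range] at this
        exact_mod_cast this

lemma sum_tailRamp_le {M H : ℕ} (hH : 1 ≤ H) (hHM : H ≤ M) :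
    ∑ n ∈ range (M + 1), tailRamp M H n ≤ H := by
  calc ∑ n ∈ range (M + 1), tailRamp M H n
      ≤ ∑ n ∈ range (M + 1), if n ∈ Ico (M + 1 - H) (M + 1) then (1 : ℝ) else 0 := by
        refine sum_le_sum fun n hn => ?_
        rw [mem_range] at hn
        split_ifs with h
        · exact tailRamp_le_one (by omega)
        · rw [mem_Ico] at h
          exact (tailRamp_of_le hH (by omega)).le
    _ = #(range (M + 1) ∩ Ico (M + 1 - H) (M + 1)) := by rw [sum_ite_mem, sum_const, nsmul_one]
    _ ≤ H := by
        have := card_le_card (inter_subset_right (s₁ := range (M + 1))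
          (s₂ := Ico (M + 1 - H) (M + 1)))
        rw [Nat.card_Ico] at this
        have h2 : M + 1 - (M + 1 - H) = H := by omega
        rw [h2] at this
        exact_mod_cast this

lemma half_le_re_addChar {t : ℝ} (ht : |t| ≤ 1 / 16) : 1 / 2 ≤ (addChar t).re := by
  rw [re_addChar, ← Real.cos_abs, ← Real.cos_pi_div_three]
  have h1 : |2 * Real.pi * t| ≤ Real.pi / 8 := by
    rw [abs_mul, abs_of_pos (by positivity : 0 < 2 * Real.pi)]
    nlinarith [Real.pi_pos]
  apply Real.cos_le_cos_of_nonneg_of_le_pi (abs_nonneg _) <;> linarith [Real.pi_pos]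

lemma abs_nat_mul_le {n M : ℕ} (hM : 1 ≤ M) (hn : n ≤ M) {β : ℝ} (hβ : |β| ≤ 1 / (16 * M)) :
    |n * β| ≤ 1 / 16 := by
  have hM' : (0 : ℝ) < M := by exact_mod_cast hM
  have hn' : (n : ℝ) ≤ M := by exact_mod_cast hn
  rw [abs_mul, Nat.abs_cast]
  calc (n : ℝ) * |β| ≤ M * (1 / (16 * M)) := by gcongr
    _ = 1 / 16 := by field_simp

/-- The contribution to the exponential sum near `r / q` of the fraction `r / q` itself. -/
lemma le_norm_sum_smoothWeight {M N H q : ℕ} (hM : 1 ≤ M) (hq : 1 ≤ q) (hqN : q ≤ N) (hH : 1 ≤ H)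
    (hHM : 8 * H ≤ M) {β : ℝ} (hβ : |β| ≤ 1 / (16 * M)) :
    (M : ℝ) / (8 * q) ≤ ‖∑ n ∈ range (M + 1), (smoothWeight M N H q n : ℂ) * addChar (n * β)‖ := by
  have hN : 1 ≤ N := hq.trans hqN
  have hM' : (0 : ℝ) < M := by exact_mod_cast hM
  have hq' : (0 : ℝ) < q := by exact_mod_cast hq
  have hcos : ∀ n ∈ range (M + 1), 1 / 2 ≤ (addChar (n * β)).re := fun n hn =>
    half_le_re_addChar (abs_nat_mul_le hM (Nat.lt_succ_iff.1 (mem_range.1 hn)) hβ)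
  have hle1 : ∀ x : ℝ, (addChar x).re ≤ 1 := fun x => by
    rw [← norm_addChar x]
    exact Complex.re_le_norm _
  refine le_trans ?_ (Complex.re_le_norm _)
  rw [Complex.re_sum]
  set P0 := fracWeight N q 0 with hP0
  have hP0' : 1 / (q : ℝ) ≤ P0 := one_div_le_fracWeight_zero hq hqN
  have hP00 : 0 ≤ P0 := fracWeight_nonneg _ _ _
  have hterm : ∀ n ∈ range (M + 1), P0 / 2 - P0 * headRamp H n - 2 * P0 * tailRamp M H n ≤
      ((smoothWeight M N H q n : ℂ) * addChar (n * β)).re := by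
    intro n hn
    rw [Complex.re_ofReal_mul, smoothWeight]
    have h1 := hcos n hn
    have h2 := hle1 (n * β)
    have h3 := fracWeight_zero_le hN q n
    have h4 := fracWeight_le_two_mul hN q M
    have h5 := headRamp_nonneg H n
    have h6 := tailRamp_nonneg M H n
    have h7 := fracWeight_nonneg N q M
    set c := (addChar (n * β)).re
    have a1 : P0 / 2 ≤ fracWeight N q n * c := by
      have : P0 * (1 / 2) ≤ fracWeight N q n * c := mul_le_mul h3 h1 (by norm_num) (hP00.trans h3)
      linarith
    have a2 : P0 * headRamp H n * c ≤ P0 * headRamp H n :=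
      mul_le_of_le_one_right (by positivity) h2
    have a3 : fracWeight N q M * tailRamp M H n * c ≤ 2 * P0 * tailRamp M H n :=
      (mul_le_of_le_one_right (by positivity) h2).trans (by gcongr)
    rw [sub_mul, sub_mul]
    linarith
  refine le_trans ?_ (sum_le_sum hterm)
  rw [sum_sub_distrib, sum_sub_distrib, ← mul_sum, ← mul_sum, sum_const, card_range, nsmul_eq_mul]
  have h1 := mul_le_mul_of_nonneg_left (sum_headRamp_le hH M) hP00
  have h2 := mul_le_mul_of_nonneg_left (sum_tailRamp_le hH (by omega : H ≤ M))
    (by positivity : 0 ≤ 2 * P0)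
  have h3 : (8 * H : ℝ) ≤ M := by exact_mod_cast hHM
  have h4 : P0 * (8 * H) ≤ P0 * M := by gcongr
  have h5 : 1 / (q : ℝ) * M ≤ P0 * M := by gcongr
  have e : (M : ℝ) / (8 * q) = 1 / q * M / 8 := by field_simp
  rw [e]
  push_cast
  linarith

/-! ### The error from a dyadic block of denominators -/

/-- The sum over the fractions with denominators in `A` of the ramps removed at `0`. -/
noncomputable def headError (N H : ℕ) (A : Finset ℕ) (x : ℝ) : ℂ :=
  ∑ p ∈ fareyPairs A, (fracWeight N p.1 0 : ℂ) *
    ∑ n ∈ Ico 1 (1 + H), (headRamp H n : ℂ) * addChar (n * (x - frac p))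

/-- The sum over the fractions with denominators in `A` of the ramps removed at `M`. -/
noncomputable def tailError (M N H : ℕ) (A : Finset ℕ) (x : ℝ) : ℂ :=
  ∑ p ∈ fareyPairs A, (fracWeight N p.1 M : ℂ) *
    ∑ n ∈ Ico (M + 1 - H) (M + 1 - H + H), (tailRamp M H n : ℂ) * addChar (n * (x - frac p))

/-- The kernel of the smooth part of the weight of the fraction `p`. -/
noncomputable def smoothKernel (M N H : ℕ) (p : (_ : ℕ) × ℕ) (x : ℝ) : ℂ :=
  ∑ n ∈ range (M + 1), (smoothWeight M N H p.1 n : ℂ) * addChar (n * x)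

/-- The contribution at `frac i + β` of the fractions with denominators in `A`, without the smooth
part of the fraction `i` itself. -/
noncomputable def blockError (M N H : ℕ) (A : Finset ℕ) (β : ℝ) (i : (_ : ℕ) × ℕ) : ℂ :=
  ∑ p ∈ (fareyPairs A).erase i, smoothKernel M N H p (frac i + β - frac p) +
    headError N H A (frac i + β) + tailError M N H A (frac i + β)

lemma sum_fracWeight_eq {M H : ℕ} (N : ℕ) (hH : 1 ≤ H) (hHM : H ≤ M) (A : Finset ℕ) (x : ℝ) :
    ∑ p ∈ fareyPairs A, ∑ n ∈ Icc 1 M, (fracWeight N p.1 n : ℂ) * addChar (n * (x - frac p)) =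
      ∑ p ∈ fareyPairs A, smoothKernel M N H p (x - frac p) +
        headError N H A x + tailError M N H A x := by
  rw [headError, tailError, ← sum_add_distrib, ← sum_add_distrib]
  refine sum_congr rfl fun p _ => ?_
  set t := x - frac p
  have h1 : smoothKernel M N H p t =
      ∑ n ∈ Icc 1 M, (smoothWeight M N H p.1 n : ℂ) * addChar (n * t) := by
    rw [smoothKernel]
    symm
    refine sum_subset (fun n hn => ?_) fun n hn hn' => ?_
    · rw [mem_Icc] at hn
      exact mem_range.2 (by omega)
    · rw [mem_range] at hn
      have : n = 0 := by
        by_contra h0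
        exact hn' (mem_Icc.2 ⟨by omega, by omega⟩)
      rw [this, smoothWeight_zero N _ hH hHM, Complex.ofReal_zero, zero_mul]
  have h2 : ∑ n ∈ Ico 1 (1 + H), (headRamp H n : ℂ) * addChar (n * t) =
      ∑ n ∈ Icc 1 M, (headRamp H n : ℂ) * addChar (n * t) := by
    refine sum_subset (fun n hn => ?_) fun n hn hn' => ?_
    · rw [mem_Ico] at hn
      exact mem_Icc.2 (by omega)
    · rw [mem_Icc] at hn
      rw [mem_Ico] at hn'
      rw [headRamp_of_ge hH (by omega), Complex.ofReal_zero, zero_mul]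
  have h3 : ∑ n ∈ Ico (M + 1 - H) (M + 1 - H + H), (tailRamp M H n : ℂ) * addChar (n * t) =
      ∑ n ∈ Icc 1 M, (tailRamp M H n : ℂ) * addChar (n * t) := by
    refine sum_subset (fun n hn => ?_) fun n hn hn' => ?_
    · rw [mem_Ico] at hn
      exact mem_Icc.2 (by omega)
    · rw [mem_Icc] at hn
      rw [mem_Ico] at hn'
      rw [tailRamp_of_le hH (by omega), Complex.ofReal_zero, zero_mul]
  rw [h1, h2, h3, mul_sum, mul_sum, ← sum_add_distrib, ← sum_add_distrib]
  refine sum_congr rfl fun n _ => ?_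
  rw [smoothWeight]
  push_cast
  ring

section Block

variable {M N Q R : ℕ} {A : Finset ℕ}

lemma card_fareyPairs_block_le (hA : ∀ q ∈ A, R ≤ q ∧ q < 2 * R) :
    (#(fareyPairs A) : ℝ) ≤ 4 * (R : ℝ) ^ 2 := by
  have : #(fareyPairs A) ≤ 4 * R ^ 2 :=
    calc #(fareyPairs A) = ∑ q ∈ A, q.totient := card_fareyPairs A
      _ ≤ ∑ q ∈ range (2 * R), 2 * R := by
          refine (sum_le_sum fun q hq => ?_).trans
            (sum_le_sum_of_subset fun q hq => mem_range.2 (hA q hq).2)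
          exact (Nat.totient_le q).trans (hA q hq).2.le
      _ = 4 * R ^ 2 := by
          rw [sum_const, card_range, smul_eq_mul]
          ring
  exact_mod_cast this

lemma inv_le_distInt_frac_block (hA : ∀ q ∈ A, q ≤ R) (β : ℝ) :
    ∀ i ∈ fareyPairs A, ∀ j ∈ fareyPairs A, i ≠ j →
      1 / (R : ℝ) ^ 2 ≤ distInt (frac i + β - (frac j + β)) := by
  intro i hi j hj hij
  rw [add_sub_add_right_eq_sub]
  refine le_trans ?_ (inv_mul_le_distInt_frac hi hj hij)
  obtain ⟨hi1, hi2, -⟩ := mem_fareyPairs.1 hi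
  obtain ⟨hj1, hj2, -⟩ := mem_fareyPairs.1 hj
  have h1 : (0 : ℝ) < i.1 := by exact_mod_cast (Nat.zero_le _).trans_lt hi2
  have h2 : (0 : ℝ) < j.1 := by exact_mod_cast (Nat.zero_le _).trans_lt hj2
  have h3 : (i.1 : ℝ) ≤ R := by exact_mod_cast hA _ hi1
  have h4 : (j.1 : ℝ) ≤ R := by exact_mod_cast hA _ hj1
  rw [sq]
  gcongr

lemma sum_sq_fracWeight_le (hR : 1 ≤ R) (hA : ∀ q ∈ A, R ≤ q ∧ q < 2 * R) (n : ℕ) :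
    ∑ p ∈ fareyPairs A, ‖(fracWeight N p.1 n : ℂ)‖ ^ 2 ≤ 16 * harmonicTail N R ^ 2 := by
  have hR' : (0 : ℝ) < R := by exact_mod_cast hR
  calc ∑ p ∈ fareyPairs A, ‖(fracWeight N p.1 n : ℂ)‖ ^ 2
      ≤ ∑ p ∈ fareyPairs A, (2 * harmonicTail N R / R) ^ 2 := by
        refine sum_le_sum fun p hp => ?_
        rw [Complex.norm_real, Real.norm_eq_abs, abs_of_nonneg (fracWeight_nonneg _ _ _)]
        have h1 := hA _ (mem_fareyPairs.1 hp).1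
        have h2 : (R : ℝ) ≤ p.1 := by exact_mod_cast h1.1
        have h3 := harmonicTail_anti N hR h1.1
        have h4 := harmonicTail_nonneg N R
        have h5 := fracWeight_nonneg N p.1 n
        have : fracWeight N p.1 n ≤ 2 * harmonicTail N R / R :=
          (fracWeight_le N p.1 n).trans (by gcongr)
        gcongr
    _ = #(fareyPairs A) * (2 * harmonicTail N R / R) ^ 2 := by rw [sum_const, nsmul_eq_mul]
    _ ≤ 4 * (R : ℝ) ^ 2 * (2 * harmonicTail N R / R) ^ 2 := by
        gcongr
        exact card_fareyPairs_block_le hA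
    _ = 16 * harmonicTail N R ^ 2 := by
        field_simp
        ring

/-- The ramps of length `QR` removed from the weights of a block contribute little in mean square
over the Farey fractions of order `Q`, by the large sieve. -/
lemma sum_sq_rampError_le (hQ : 1 ≤ Q) (hR : 1 ≤ R) (hRN : R ≤ 2 * N) (hQN : 16 * Q ≤ N)
    (hA : ∀ q ∈ A, R ≤ q ∧ q < 2 * R) (β : ℝ) (ω : ℕ → ℝ) (n₀ m : ℕ)
    (hω : ∀ n ∈ Ico n₀ (n₀ + Q * R), |ω n| ≤ 1) :
    ∑ i ∈ fareyPairs (Icc 1 Q), ‖∑ p ∈ fareyPairs A, (fracWeight N p.1 m : ℂ) *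
      ∑ n ∈ Ico n₀ (n₀ + Q * R), (ω n : ℂ) * addChar (n * (frac i + β - frac p))‖ ^ 2 ≤
      700000 * (Q * N ^ 2 * R) * harmonicTail N R ^ 2 := by
  have hR' : (0 : ℝ) < R := by exact_mod_cast hR
  have hQ' : (0 : ℝ) < Q := by exact_mod_cast hQ
  have hx := inv_le_distInt_frac_block (A := Icc 1 Q) (R := Q) (fun q hq => (mem_Icc.1 hq).2) β
  have hy := inv_le_distInt_frac_block (A := A) (R := 2 * R) (fun q hq => (hA q hq).2.le) 0
  simp only [add_zero] at hy
  have h := bilinear_large_sieve (fareyPairs (Icc 1 Q)) (fun i => frac i + β) (fareyPairs A) frac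
    (fun p => (fracWeight N p.1 m : ℂ)) ω (L₁ := Q * R + Q ^ 2) (L₂ := Q * R + (2 * R) ^ 2)
    (H := Q * R) n₀ hω (by positivity) (Nat.le_add_right_of_le (Nat.mul_pos hQ hR))
    (Nat.le_add_right _ _) ?_ hx (by positivity) (Nat.le_add_right_of_le (Nat.mul_pos hQ hR))
    (Nat.le_add_right _ _) ?_ hy
  · refine h.trans ?_
    have h1 := sum_sq_fracWeight_le (N := N) hR hA m
    have h2 : ((Q * R + Q ^ 2 : ℕ) : ℝ) * ((Q * R + (2 * R) ^ 2 : ℕ) : ℝ) ≤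
        27 * (Q * N ^ 2 * R) := by
      have a1 : (R : ℝ) ≤ 2 * N := by exact_mod_cast hRN
      have a2 : (16 * Q : ℝ) ≤ N := by exact_mod_cast hQN
      push_cast
      calc ((Q : ℝ) * R + Q ^ 2) * (Q * R + (2 * R) ^ 2) = Q * R * ((R + Q) * (Q + 4 * R)) := by
            ring
        _ ≤ Q * R * ((3 * N) * (9 * N)) := by
            gcongr <;> linarith
        _ = _ := by ring
    calc _ = 1600 * (((Q * R + Q ^ 2 : ℕ) : ℝ) * ((Q * R + (2 * R) ^ 2 : ℕ) : ℝ)) *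
          ∑ p ∈ fareyPairs A, ‖(fracWeight N p.1 m : ℂ)‖ ^ 2 := by ring
      _ ≤ 1600 * (27 * (Q * N ^ 2 * R)) * (16 * harmonicTail N R ^ 2) := by gcongr
      _ ≤ _ := by
          have : 0 ≤ (Q * N ^ 2 * R : ℝ) * harmonicTail N R ^ 2 := by positivity
          linarith
  · push_cast
    rw [mul_one_div, le_div_iff₀ (by positivity), one_mul]
    exact le_add_of_nonneg_left (by positivity)
  · push_cast
    rw [mul_one_div, le_div_iff₀ (by positivity), one_mul]
    exact le_add_of_nonneg_left (by positivity)

/-- The smooth parts of the weights of a block contribute little in mean square over the Farey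
fractions of order `Q`, since distinct fractions are at distance at least `1 / (4QR)`. -/
lemma sum_sq_smoothError_le (hQ : 1 ≤ Q) (hR : 1 ≤ R) (hRN : R ≤ 2 * N) (hQN : 16 * Q ≤ N)
    (hNM : N ^ 2 ≤ M) (hA : ∀ q ∈ A, R ≤ q ∧ q < 2 * R) {β : ℝ} (hβ : |β| ≤ 1 / (16 * M)) :
    ∑ i ∈ fareyPairs (Icc 1 Q), ‖∑ p ∈ (fareyPairs A).erase i,
      smoothKernel M N (Q * R) p (frac i + β - frac p)‖ ^ 2 ≤
      1000000 * (Q * N ^ 2 * R) * harmonicTail N R ^ 2 := by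
  have hR' : (0 : ℝ) < R := by exact_mod_cast hR
  have hQ' : (0 : ℝ) < Q := by exact_mod_cast hQ
  have hN : 1 ≤ N := by omega
  have hM : 1 ≤ M := le_trans (Nat.one_le_pow _ _ hN) hNM
  have hQR : 1 ≤ Q * R := Nat.mul_pos hQ hR
  have hQRM : 8 * (Q * R) ≤ M := by nlinarith
  set L := harmonicTail N R with hL
  have hL0 : 0 ≤ L := harmonicTail_nonneg N R
  have hx := inv_le_distInt_frac_block (A := Icc 1 Q) (R := Q) (fun q hq => (mem_Icc.1 hq).2) β
  have hy := inv_le_distInt_frac_block (A := A) (R := 2 * R) (fun q hq => (hA q hq).2.le) 0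
  simp only [add_zero] at hy
  have hgap : ∀ i ∈ fareyPairs (Icc 1 Q), ∀ j ∈ fareyPairs A, i ≠ j →
      1 / (4 * Q * R : ℝ) ≤ distInt (frac i + β - frac j) := by
    intro i hi j hj hij
    obtain ⟨hi1, hi2, -⟩ := mem_fareyPairs.1 hi
    obtain ⟨hj1, hj2, -⟩ := mem_fareyPairs.1 hj
    have h1 : (0 : ℝ) < i.1 := by exact_mod_cast (Nat.zero_le _).trans_lt hi2
    have h2 : (0 : ℝ) < j.1 := by exact_mod_cast (Nat.zero_le _).trans_lt hj2
    have h3 : (i.1 : ℝ) ≤ Q := by exact_mod_cast (mem_Icc.1 hi1).2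
    have h4 : (j.1 : ℝ) ≤ 2 * R := by exact_mod_cast (hA _ hj1).2.le
    have h5 := inv_mul_le_distInt_frac hi hj hij
    have h6 : 1 / ((Q : ℝ) * (2 * R)) ≤ 1 / ((i.1 : ℝ) * j.1) := by gcongr
    have h7 := distInt_add_le (frac i + β - frac j) (-β)
    rw [show frac i + β - frac j + -β = frac i - frac j by ring, abs_neg] at h7
    have h8 : 1 / (16 * M : ℝ) ≤ 1 / (4 * Q * R) := by
      have : (8 * (Q * R) : ℝ) ≤ M := by exact_mod_cast hQRM
      apply one_div_le_one_div_of_le (by positivity)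
      nlinarith [mul_pos hQ' hR']
    have h9 : 1 / ((Q : ℝ) * (2 * R)) = 1 / (4 * Q * R) + 1 / (4 * Q * R) := by
      field_simp
      norm_num
    linarith
  have hK : ∀ i ∈ fareyPairs (Icc 1 Q), ∀ j ∈ fareyPairs A, i ≠ j →
      ‖smoothKernel M N (Q * R) j (frac i + β - frac j)‖ ≤
        (24 * L / (R * (Q * R)) / 16) * (1 / distInt (frac i + β - frac j) ^ 2) := by
    intro i hi j hj hij
    have hpos : 0 < distInt (frac i + β - frac j) :=
      lt_of_lt_of_le (by positivity) (hgap i hi j hj hij)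
    obtain ⟨hj1, hj2, -⟩ := mem_fareyPairs.1 hj
    obtain ⟨hjR, hjR'⟩ := hA _ hj1
    have hj0 : 1 ≤ j.1 := hR.trans hjR
    have hRj : (R : ℝ) ≤ j.1 := by exact_mod_cast hjR
    have hHN : Q * R ≤ j.1 * N := by nlinarith
    refine (norm_sum_mul_addChar_le _ hM (smoothWeight_zero N _ hQR (by omega))
      (smoothWeight_top N _ hQR (by omega)) hpos).trans ?_
    have h1 := slopeVar_smoothWeight_le hN hM hj0 hQR hHN
    have h2 : 24 * harmonicTail N j.1 / (j.1 * (Q * R : ℕ)) ≤ 24 * L / (R * (Q * R)) := by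
      have := harmonicTail_anti N hR hjR
      push_cast
      gcongr
    rw [mul_div_right_comm]
    gcongr
    exact h1.trans h2
  refine (sum_sq_offDiag_le (fareyPairs (Icc 1 Q)) (fareyPairs A) (fun i => frac i + β) frac
    (fun i j => smoothKernel M N (Q * R) j (frac i + β - frac j)) (by positivity)
    (γ := 1 / (4 * Q * R : ℝ)) (by positivity) (by positivity) (by positivity)
    hK hgap hx hy).trans ?_
  have hcard := card_fareyPairs_block_le hA
  have a1 : (R : ℝ) ≤ 2 * N := by exact_mod_cast hRN
  have a2 : (16 * Q : ℝ) ≤ N := by exact_mod_cast hQN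
  push_cast
  calc _ ≤ 4 * (R : ℝ) ^ 2 * (24 * L / (R * (Q * R)) / 16 *
          (8 * (1 / (1 / (4 * Q * R : ℝ)) ^ 2 + 1 / (1 / (4 * Q * R : ℝ) * (1 / Q ^ 2))))) *
        (24 * L / (R * (Q * R)) / 16 *
          (8 * (1 / (1 / (4 * Q * R : ℝ)) ^ 2 + 1 / (1 / (4 * Q * R : ℝ) * (1 / (2 * R) ^ 2))))) := by
        gcongr
    _ = 36864 * (Q * R) * ((4 * R + Q) * (Q + R)) * L ^ 2 := by
        field_simp
        ring
    _ ≤ 36864 * (Q * R) * ((9 * N) * (3 * N)) * L ^ 2 := by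
        gcongr <;> linarith
    _ ≤ _ := by
        have : 0 ≤ (Q * N ^ 2 * R : ℝ) * L ^ 2 := by positivity
        linarith

lemma sum_sq_blockError_le (hQ : 1 ≤ Q) (hR : 1 ≤ R) (hRN : R ≤ 2 * N) (hQN : 16 * Q ≤ N)
    (hNM : N ^ 2 ≤ M) (hA : ∀ q ∈ A, R ≤ q ∧ q < 2 * R) {β : ℝ} (hβ : |β| ≤ 1 / (16 * M)) :
    ∑ i ∈ fareyPairs (Icc 1 Q), ‖blockError M N (Q * R) A β i‖ ^ 2 ≤
      10000000 * (Q * N ^ 2 * R) * harmonicTail N R ^ 2 := by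
  have hQR : 1 ≤ Q * R := Nat.mul_pos hQ hR
  have hQRM : 8 * (Q * R) ≤ M := by nlinarith
  have h1 := sum_sq_smoothError_le hQ hR hRN hQN hNM hA hβ
  have h2 := sum_sq_rampError_le (N := N) hQ hR hRN hQN hA β (headRamp (Q * R)) 1 0 fun n _ => by
    rw [abs_of_nonneg (headRamp_nonneg _ _)]
    exact headRamp_le_one _ _
  have h3 := sum_sq_rampError_le (N := N) hQ hR hRN hQN hA β (tailRamp M (Q * R))
    (M + 1 - Q * R) M fun n hn => by
      rw [abs_of_nonneg (tailRamp_nonneg _ _ _)]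
      rw [mem_Ico] at hn
      exact tailRamp_le_one (by omega)
  have h4 : ∀ a b c : ℂ, ‖a + b + c‖ ^ 2 ≤ 3 * (‖a‖ ^ 2 + ‖b‖ ^ 2 + ‖c‖ ^ 2) := by
    intro a b c
    have h : ‖a + b + c‖ ≤ ‖a‖ + ‖b‖ + ‖c‖ := norm_add₃_le
    have h' : ‖a + b + c‖ ^ 2 ≤ (‖a‖ + ‖b‖ + ‖c‖) ^ 2 := by gcongr
    nlinarith [sq_nonneg (‖a‖ - ‖b‖), sq_nonneg (‖a‖ - ‖c‖), sq_nonneg (‖b‖ - ‖c‖)]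
  calc ∑ i ∈ fareyPairs (Icc 1 Q), ‖blockError M N (Q * R) A β i‖ ^ 2
      ≤ ∑ i ∈ fareyPairs (Icc 1 Q), 3 * (‖∑ p ∈ (fareyPairs A).erase i,
        smoothKernel M N (Q * R) p (frac i + β - frac p)‖ ^ 2 +
          ‖headError N (Q * R) A (frac i + β)‖ ^ 2 + ‖tailError M N (Q * R) A (frac i + β)‖ ^ 2) :=
        sum_le_sum fun i _ => h4 _ _ _
    _ ≤ _ := by
        rw [← mul_sum, sum_add_distrib, sum_add_distrib]
        unfold headError tailError
        have : 0 ≤ (Q * N ^ 2 * R : ℝ) * harmonicTail N R ^ 2 := by positivity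
        linarith

end Block

/-! ### The total error in mean square -/

lemma sum_Ico_inv_le (j : ℕ) : ∑ g ∈ Ico (1 : ℕ) (2 ^ j), 1 / (g : ℝ) ≤ j := by
  induction j with
  | zero => simp
  | succ j ih =>
    rw [← sum_Ico_consecutive _ (Nat.one_le_two_pow (n := j))
      (Nat.pow_le_pow_right (by norm_num) (Nat.le_succ j))]
    have h : ∑ g ∈ Ico ((2 : ℕ) ^ j) (2 ^ (j + 1)), 1 / (g : ℝ) ≤ 1 := by
      calc ∑ g ∈ Ico ((2 : ℕ) ^ j) (2 ^ (j + 1)), 1 / (g : ℝ)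
          ≤ ∑ g ∈ Ico ((2 : ℕ) ^ j) (2 ^ (j + 1)), 1 / (2 : ℝ) ^ j := by
            refine sum_le_sum fun g hg => ?_
            have : ((2 : ℝ) ^ j) ≤ g := by exact_mod_cast (mem_Ico.1 hg).1
            gcongr
        _ = 1 := by
            rw [sum_const, Nat.card_Ico, nsmul_eq_mul]
            have : 2 ^ (j + 1) - 2 ^ j = 2 ^ j := by
              rw [pow_succ]
              omega
            rw [this]
            push_cast
            field_simp
    push_cast
    linarith

lemma harmonicTail_two_pow_le {N K j : ℕ} (hK : 2 * N < 2 ^ (K + 1)) (hj : j ≤ K) :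
    harmonicTail N (2 ^ (K - j)) ≤ j + 1 := by
  have h : 2 * N / 2 ^ (K - j) < 2 ^ (j + 1) := by
    rw [Nat.div_lt_iff_lt_mul (by positivity), ← pow_add]
    rwa [show j + 1 + (K - j) = K + 1 by omega]
  refine le_trans ?_ ((sum_Ico_inv_le (j + 1)).trans_eq (by push_cast; ring))
  refine sum_le_sum_of_subset_of_nonneg (fun g hg => ?_) fun _ _ _ => by positivity
  rw [mem_Icc] at hg
  exact mem_Ico.2 ⟨hg.1, hg.2.trans_lt h⟩

lemma geom_sum_le {r : ℝ} (h0 : 0 ≤ r) (h1 : r < 1) (n : ℕ) :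
    ∑ j ∈ range n, r ^ j ≤ 1 / (1 - r) := by
  rw [le_div_iff₀ (by linarith), geom_sum_mul_neg]
  linarith [pow_nonneg h0 n]

/-- Since `(j + 1)² ≤ 64 (81/64) ^ j`, the series `∑ (j + 1)² (2/3) ^ j` is dominated by a
geometric one. -/
lemma sum_sq_mul_geom_le (n : ℕ) :
    ∑ j ∈ range n, ((j : ℝ) + 1) ^ 2 * (2 / 3) ^ j ≤ 410 := by
  calc ∑ j ∈ range n, ((j : ℝ) + 1) ^ 2 * (2 / 3) ^ j
      ≤ ∑ j ∈ range n, 64 * (27 / 32 : ℝ) ^ j := by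
        refine sum_le_sum fun j _ => ?_
        have h1 := one_add_mul_le_pow (by norm_num : (-2 : ℝ) ≤ 1 / 8) j
        have h2 : ((j : ℝ) + 1) ^ 2 ≤ 64 * (81 / 64 : ℝ) ^ j := by
          have e : (81 / 64 : ℝ) ^ j = ((1 + 1 / 8 : ℝ) ^ j) ^ 2 := by
            rw [← pow_mul, mul_comm, pow_mul]
            norm_num
          rw [e]
          have h3 : (0 : ℝ) ≤ j := by positivity
          have h4 : (j : ℝ) + 1 ≤ 8 * (1 + 1 / 8 : ℝ) ^ j := by linarith
          calc ((j : ℝ) + 1) ^ 2 ≤ (8 * (1 + 1 / 8 : ℝ) ^ j) ^ 2 := by gcongr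
            _ = _ := by ring
        calc ((j : ℝ) + 1) ^ 2 * (2 / 3) ^ j ≤ 64 * (81 / 64 : ℝ) ^ j * (2 / 3) ^ j := by gcongr
          _ = 64 * (27 / 32 : ℝ) ^ j := by
            rw [mul_assoc, ← mul_pow]
            norm_num
    _ ≤ 64 * (1 / (1 - 27 / 32)) := by
        rw [← mul_sum]
        gcongr
        exact geom_sum_le (by norm_num) (by norm_num) n
    _ ≤ 410 := by norm_num

/-- The denominators up to `2N` in `[2 ^ k, 2 ^ (k + 1))`. -/
def dyadicBlock (N k : ℕ) : Finset ℕ := (Icc 1 (2 * N)).filter fun q => Nat.log 2 q = k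

lemma mem_dyadicBlock {N k q : ℕ} :
    q ∈ dyadicBlock N k ↔ (1 ≤ q ∧ q ≤ 2 * N) ∧ Nat.log 2 q = k := by
  simp [dyadicBlock]

lemma dyadicBlock_bounds {N k q : ℕ} (hq : q ∈ dyadicBlock N k) : 2 ^ k ≤ q ∧ q < 2 * 2 ^ k := by
  obtain ⟨⟨h1, -⟩, rfl⟩ := mem_dyadicBlock.1 hq
  refine ⟨Nat.pow_log_le_self 2 (by omega), ?_⟩
  rw [← pow_succ']
  exact Nat.lt_pow_succ_log_self (by norm_num) q

/-- The sum of the errors of all dyadic blocks. -/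
noncomputable def totalError (M N Q : ℕ) (β : ℝ) (i : (_ : ℕ) × ℕ) : ℂ :=
  ∑ k ∈ range (Nat.log 2 (2 * N) + 1), blockError M N (Q * 2 ^ k) (dyadicBlock N k) β i

/-- The mean squares of the block errors decay geometrically away from the top block, so that the
blocks can be combined by Cauchy's inequality with geometric weights. -/
lemma sum_sq_totalError_le {M N Q : ℕ} (hQ : 1 ≤ Q) (hQN : 16 * Q ≤ N) (hNM : N ^ 2 ≤ M) {β : ℝ}
    (hβ : |β| ≤ 1 / (16 * M)) :
    ∑ i ∈ fareyPairs (Icc 1 Q), ‖totalError M N Q β i‖ ^ 2 ≤ 40000000000 * (Q * N ^ 3) := by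
  set K := Nat.log 2 (2 * N) with hK
  have hK1 : 2 * N < 2 ^ (K + 1) := Nat.lt_pow_succ_log_self (by norm_num) _
  have hK2 : 2 ^ K ≤ 2 * N := Nat.pow_log_le_self 2 (by omega)
  set E : ℕ → ((_ : ℕ) × ℕ) → ℂ := fun j i =>
    blockError M N (Q * 2 ^ (K - j)) (dyadicBlock N (K - j)) β i with hE
  have hblock : ∀ j ∈ range (K + 1), ∑ i ∈ fareyPairs (Icc 1 Q), ‖E j i‖ ^ 2 ≤
      20000000 * (Q * N ^ 3) * (((j : ℝ) + 1) ^ 2 * (1 / 2) ^ j) := by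
    intro j hj
    have hjK : j ≤ K := Nat.lt_succ_iff.1 (mem_range.1 hj)
    have h1 : (2 : ℝ) ^ (K - j) ≤ 2 * N * (1 / 2) ^ j := by
      have a1 : (2 : ℝ) ^ (K - j) = 2 ^ K * (1 / 2) ^ j := by
        rw [one_div, inv_pow, ← div_eq_mul_inv, eq_div_iff (by positivity), ← pow_add,
          Nat.sub_add_cancel hjK]
      have a2 : (2 : ℝ) ^ K ≤ 2 * N := by exact_mod_cast hK2
      rw [a1]
      gcongr
    have h2 := harmonicTail_two_pow_le hK1 hjK
    have h3 := harmonicTail_nonneg N (2 ^ (K - j))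
    refine (sum_sq_blockError_le hQ Nat.one_le_two_pow
      ((Nat.pow_le_pow_right (by norm_num) (Nat.sub_le K j)).trans hK2) hQN hNM
      (fun q hq => dyadicBlock_bounds hq) hβ).trans ?_
    push_cast
    calc 10000000 * ((Q : ℝ) * N ^ 2 * 2 ^ (K - j)) * harmonicTail N (2 ^ (K - j)) ^ 2
        ≤ 10000000 * ((Q : ℝ) * N ^ 2 * (2 * N * (1 / 2) ^ j)) * ((j : ℝ) + 1) ^ 2 := by gcongr
      _ = _ := by ring
  have htot : ∀ i, totalError M N Q β i = ∑ j ∈ range (K + 1), E j i := by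
    intro i
    rw [totalError, ← sum_range_reflect]
    refine sum_congr rfl fun j _ => ?_
    rw [hE, show K + 1 - 1 - j = K - j by omega]
  have hcs : ∀ i, ‖totalError M N Q β i‖ ^ 2 ≤
      4 * ∑ j ∈ range (K + 1), (4 / 3 : ℝ) ^ j * ‖E j i‖ ^ 2 := by
    intro i
    have h1 : ‖totalError M N Q β i‖ ≤ ∑ j ∈ range (K + 1), ‖E j i‖ := by
      rw [htot]
      exact norm_sum_le _ _
    have h2 := sum_sq_le_sum_mul_sum_of_sq_le_mul (range (K + 1))
      (r := fun j => ‖E j i‖) (f := fun j => (3 / 4 : ℝ) ^ j)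
      (g := fun j => (4 / 3 : ℝ) ^ j * ‖E j i‖ ^ 2) (fun _ _ => by positivity)
      (fun _ _ => by positivity) (fun j _ => by
        rw [← mul_assoc, ← mul_pow]
        norm_num)
    have h3 : ∑ j ∈ range (K + 1), (3 / 4 : ℝ) ^ j ≤ 4 :=
      (geom_sum_le (by norm_num) (by norm_num) _).trans_eq (by norm_num)
    calc ‖totalError M N Q β i‖ ^ 2 ≤ (∑ j ∈ range (K + 1), ‖E j i‖) ^ 2 := by gcongr
      _ ≤ _ := h2
      _ ≤ _ := by gcongr
  calc ∑ i ∈ fareyPairs (Icc 1 Q), ‖totalError M N Q β i‖ ^ 2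
      ≤ ∑ i ∈ fareyPairs (Icc 1 Q), 4 * ∑ j ∈ range (K + 1), (4 / 3 : ℝ) ^ j * ‖E j i‖ ^ 2 :=
        sum_le_sum fun i _ => hcs i
    _ = 4 * ∑ j ∈ range (K + 1), (4 / 3 : ℝ) ^ j *
          ∑ i ∈ fareyPairs (Icc 1 Q), ‖E j i‖ ^ 2 := by
        rw [← mul_sum, sum_comm]
        simp only [mul_sum]
    _ ≤ 4 * ∑ j ∈ range (K + 1), (4 / 3 : ℝ) ^ j *
          (20000000 * (Q * N ^ 3) * (((j : ℝ) + 1) ^ 2 * (1 / 2) ^ j)) := by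
        gcongr with j hj
        exact hblock j hj
    _ = 80000000 * (Q * N ^ 3) * ∑ j ∈ range (K + 1), ((j : ℝ) + 1) ^ 2 * (2 / 3) ^ j := by
        rw [mul_sum, mul_sum]
        refine sum_congr rfl fun j _ => ?_
        have : (2 / 3 : ℝ) ^ j = (4 / 3) ^ j * (1 / 2) ^ j := by
          rw [← mul_pow]
          norm_num
        rw [this]
        ring
    _ ≤ 80000000 * (Q * N ^ 3) * 410 := by
        gcongr
        exact sum_sq_mul_geom_le _
    _ ≤ _ := by
        have : (0 : ℝ) ≤ Q * N ^ 3 := by positivity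
        linarith

/-! ### Large values near fractions of large denominator -/

lemma divisorExpSum_eq_sum_frac {M N : ℕ} (hN : 1 ≤ N) (hMN : M < (N + 1) ^ 2) {X : ℝ}
    (hX : ⌊X⌋₊ = M) (x : ℝ) :
    divisorExpSum x X = ∑ p ∈ fareyPairs (Icc 1 (2 * N)), ∑ n ∈ Icc 1 M,
      (fracWeight N p.1 n : ℂ) * addChar (n * (x - frac p)) := by
  have h := sum_dvd_eq_sum_frac (divisorWeight N) (2 * N) M x
  rw [divisorExpSum, hX]
  unfold fracWeight
  rw [← h]
  refine sum_congr rfl fun n hn => ?_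
  rw [mem_Icc] at hn
  rw [← card_divisors_eq_sum_divisorWeight hN hn.1 (hn.2.trans_lt hMN), Complex.ofReal_natCast]

/-- Near a fraction of denominator at most `Q`, the exponential sum is the smooth contribution of
this fraction plus the total error. -/
lemma divisorExpSum_eq_add_totalError {M N Q : ℕ} (hQ : 1 ≤ Q) (hQN : 16 * Q ≤ N)
    (hNM : N ^ 2 ≤ M) (hMN : M < (N + 1) ^ 2) {X : ℝ} (hX : ⌊X⌋₊ = M) (β : ℝ)
    {i : (_ : ℕ) × ℕ} (hi : i ∈ fareyPairs (Icc 1 Q)) :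
    divisorExpSum (frac i + β) X =
      smoothKernel M N (Q * 2 ^ Nat.log 2 i.1) i β + totalError M N Q β i := by
  have hN : 1 ≤ N := by omega
  set x := frac i + β with hx
  set K := Nat.log 2 (2 * N) with hK
  have hK2 : 2 ^ K ≤ 2 * N := Nat.pow_log_le_self 2 (by omega)
  have hsplit : ∀ F : ((_ : ℕ) × ℕ) → ℂ, ∑ p ∈ fareyPairs (Icc 1 (2 * N)), F p =
      ∑ k ∈ range (K + 1), ∑ p ∈ fareyPairs (dyadicBlock N k), F p := by
    intro F
    simp only [fareyPairs, sum_sigma]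
    symm
    refine sum_fiberwise_of_maps_to (g := Nat.log 2) (fun q hq => ?_) _
    rw [mem_range, Nat.lt_succ_iff]
    exact Nat.log_mono_right (mem_Icc.1 hq).2
  obtain ⟨hi1, hi2, hi3⟩ := mem_fareyPairs.1 hi
  rw [mem_Icc] at hi1
  have hmem : ∀ k, i ∈ fareyPairs (dyadicBlock N k) ↔ Nat.log 2 i.1 = k := by
    intro k
    rw [mem_fareyPairs, mem_dyadicBlock]
    constructor
    · exact fun h => h.1.2
    · exact fun h => ⟨⟨⟨hi1.1, by omega⟩, h⟩, hi2, hi3⟩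
  have hblock : ∀ k ∈ range (K + 1), ∑ p ∈ fareyPairs (dyadicBlock N k), ∑ n ∈ Icc 1 M,
      (fracWeight N p.1 n : ℂ) * addChar (n * (x - frac p)) =
      (if Nat.log 2 i.1 = k then smoothKernel M N (Q * 2 ^ k) i β else 0) +
        blockError M N (Q * 2 ^ k) (dyadicBlock N k) β i := by
    intro k hk
    have hk2 : 2 ^ k ≤ 2 * N :=
      (Nat.pow_le_pow_right (by norm_num) (Nat.lt_succ_iff.1 (mem_range.1 hk))).trans hK2
    have hH : 1 ≤ Q * 2 ^ k := Nat.mul_pos hQ (by positivity)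
    rw [sum_fracWeight_eq N hH (by nlinarith), blockError, ← hx]
    have hb : x - frac i = β := by rw [hx]; ring
    split_ifs with h
    · rw [← add_sum_erase _ _ ((hmem k).2 h), hb]
      ring
    · rw [erase_eq_of_notMem fun h' => h ((hmem k).1 h'), zero_add]
  rw [divisorExpSum_eq_sum_frac hN hMN hX, hsplit, sum_congr rfl hblock, sum_add_distrib,
    sum_ite_eq, if_pos, totalError]
  rw [mem_range, Nat.lt_succ_iff]
  exact Nat.log_mono_right (by omega)

/-- For a positive proportion of the fractions of denominator at most `Q`, the sum is at least `N`
near the fraction. The fraction itself contributes at least `N² / (8Q)`, and Chebyshev's inequality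
applies to the total error once `N / Q` is large. -/
lemma card_large_values_ge {M N Q : ℕ} (hQ : 1 ≤ Q) (hQN : 10 ^ 15 * Q ≤ N)
    (hNM : N ^ 2 ≤ M) (hMN : M < (N + 1) ^ 2) {X : ℝ} (hX : ⌊X⌋₊ = M) {β : ℝ}
    (hβ : |β| ≤ 1 / (16 * M)) :
    (Q : ℝ) ^ 2 / 32 ≤
      #{i ∈ fareyPairs (Icc 1 Q) | (N : ℝ) ≤ ‖divisorExpSum (frac i + β) X‖} := by
  have hQN' : 16 * Q ≤ N := by omega
  have hM : 1 ≤ M := le_trans (Nat.one_le_pow _ _ (by omega)) hNM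
  have hQ' : (0 : ℝ) < Q := by exact_mod_cast hQ
  have hQNr : (10 ^ 15 * Q : ℝ) ≤ N := by exact_mod_cast hQN
  have hN' : (0 : ℝ) < N := by nlinarith
  set I := fareyPairs (Icc 1 Q) with hI
  set T : ℝ := (N : ℝ) ^ 2 / (16 * Q) with hT
  have hT0 : 0 < T := by positivity
  have hNT : (N : ℝ) ≤ T := by
    rw [hT, le_div_iff₀ (by positivity)]
    nlinarith
  have herr : ∀ i ∈ I.filter fun i => ¬ (N : ℝ) ≤ ‖divisorExpSum (frac i + β) X‖,
      T ≤ ‖totalError M N Q β i‖ := by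
    intro i hi
    rw [mem_filter, not_le] at hi
    obtain ⟨hi1, hi2, -⟩ := mem_fareyPairs.1 hi.1
    rw [mem_Icc] at hi1
    have hpow : 2 ^ Nat.log 2 i.1 ≤ i.1 := Nat.pow_log_le_self 2 (by omega)
    have h1 := le_norm_sum_smoothWeight (N := N) (H := Q * 2 ^ Nat.log 2 i.1) hM hi1.1
      (by omega) (Nat.mul_pos hQ (by positivity)) (by nlinarith) hβ
    have h2 := divisorExpSum_eq_add_totalError hQ hQN' hNM hMN hX β hi.1
    have h3 : 2 * T ≤ (M : ℝ) / (8 * i.1) := by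
      have a1 : ((N : ℝ) ^ 2) ≤ M := by exact_mod_cast hNM
      have a2 : (i.1 : ℝ) ≤ Q := by exact_mod_cast hi1.2
      have a3 : (0 : ℝ) < i.1 := by exact_mod_cast hi1.1
      calc 2 * T = (N : ℝ) ^ 2 / (8 * Q) := by
            rw [hT]
            field_simp
            norm_num
        _ ≤ _ := by gcongr
    have h4 : ‖smoothKernel M N (Q * 2 ^ Nat.log 2 i.1) i β‖ ≤
        ‖divisorExpSum (frac i + β) X‖ + ‖totalError M N Q β i‖ := by
      rw [h2]
      exact norm_le_add_norm_add _ _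
    unfold smoothKernel at h4
    linarith [hi.2]
  have hbad : (#{i ∈ I | ¬ (N : ℝ) ≤ ‖divisorExpSum (frac i + β) X‖} : ℝ) ≤ Q ^ 2 / 32 := by
    have h1 : (#{i ∈ I | ¬ (N : ℝ) ≤ ‖divisorExpSum (frac i + β) X‖} : ℝ) * T ^ 2 ≤
        40000000000 * (Q * N ^ 3) := by
      refine le_trans ?_ (sum_sq_totalError_le hQ hQN' hNM hβ)
      rw [← nsmul_eq_mul, ← sum_const]
      refine le_trans (sum_le_sum (g := fun i => ‖totalError M N Q β i‖ ^ 2) fun i hi => ?_)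
        (sum_le_sum_of_subset_of_nonneg (filter_subset _ _) fun _ _ _ => by positivity)
      have := herr i hi
      gcongr
    rw [← le_div_iff₀ (by positivity)] at h1
    refine h1.trans ?_
    rw [div_le_iff₀ (by positivity)]
    -- The factor `10 ^ 15` exceeds `8192` times the constant in `sum_sq_totalError_le`.
    have e : (Q : ℝ) ^ 2 / 32 * T ^ 2 = N ^ 3 * N / 8192 := by
      rw [hT]
      field_simp
      norm_num
    rw [e]
    have : (N : ℝ) ^ 3 * (10 ^ 15 * Q) ≤ N ^ 3 * N := by gcongr
    have h0 : 0 ≤ (N : ℝ) ^ 3 * Q := by positivity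
    linarith
  have hcard : (Q : ℝ) ^ 2 / 16 ≤ #I := by
    rw [hI, card_fareyPairs]
    push_cast
    exact sq_le_sum_totient Q
  have hadd := card_filter_add_card_filter_not (s := I)
    fun i => (N : ℝ) ≤ ‖divisorExpSum (frac i + β) X‖
  have hadd' : (#{i ∈ I | (N : ℝ) ≤ ‖divisorExpSum (frac i + β) X‖} : ℝ) +
      #{i ∈ I | ¬ (N : ℝ) ≤ ‖divisorExpSum (frac i + β) X‖} = #I := by exact_mod_cast hadd
  linarith

/-! ### From large values to the moment -/

lemma continuous_divisorExpSum (X : ℝ) : Continuous fun x => divisorExpSum x X := by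
  unfold divisorExpSum
  have := continuous_addChar
  fun_prop

lemma divisorExpSum_add_one (x X : ℝ) : divisorExpSum (x + 1) X = divisorExpSum x X := by
  refine sum_congr rfl fun n _ => ?_
  have h := addChar_int n
  rw [Int.cast_natCast] at h
  rw [mul_add, mul_one, addChar_add, h, mul_one]

/-- The arcs of radius `η` about the fractions of denominator at most `Q` are disjoint, so the
integrals over them add up to at most the integral over a period. -/
lemma intervalIntegral_sum_frac_le {f : ℝ → ℝ} (hf : Continuous f) (hf0 : ∀ x, 0 ≤ f x)
    (hper : Function.Periodic f 1) {Q : ℕ} (hQ : 1 ≤ Q) {η : ℝ} (hη : 0 < η)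
    (hηQ : 2 * η ≤ 1 / (Q : ℝ) ^ 2) :
    ∫ β in (-η)..η, ∑ i ∈ fareyPairs (Icc 1 Q), f (frac i + β) ≤ ∫ x in (0 : ℝ)..1, f x := by
  have hQ' : (1 : ℝ) ≤ Q := by exact_mod_cast hQ
  have h1 : ∫ x in (0 : ℝ)..1, f x = ∫ x in (-η)..(-η + 1), f x := by
    have := hper.intervalIntegral_add_eq 0 (-η)
    rwa [zero_add] at this
  have h2 : ∀ i : (_ : ℕ) × ℕ, ∫ β in (-η)..η, f (frac i + β) =
      ∫ x in Set.Ioc (frac i - η) (frac i + η), f x := by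
    intro i
    rw [intervalIntegral.integral_comp_add_left (fun x => f x) (frac i), ← sub_eq_add_neg,
      intervalIntegral.integral_of_le (by linarith)]
  have hint : ∀ a b : ℝ, MeasureTheory.IntegrableOn f (Set.Ioc a b) := fun a b =>
    (hf.integrableOn_Icc).mono_set Set.Ioc_subset_Icc_self
  have hdisj : Set.Pairwise (fareyPairs (Icc 1 Q) : Set ((_ : ℕ) × ℕ))
      (Function.onFun Disjoint fun i => Set.Ioc (frac i - η) (frac i + η)) := by
    intro i hi j hj hij
    have h3 := inv_le_distInt_frac_block (A := Icc 1 Q) (R := Q) (fun q hq => (mem_Icc.1 hq).2) 0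
      i hi j hj hij
    simp only [add_zero] at h3
    have h4 := distInt_le_abs_sub (frac i - frac j) 0
    rw [Int.cast_zero, sub_zero] at h4
    have h5 : 2 * η ≤ |frac i - frac j| := hηQ.trans (h3.trans h4)
    rw [Function.onFun, Set.disjoint_left]
    intro x hx hx'
    rw [Set.mem_Ioc] at hx hx'
    have : |frac i - frac j| < 2 * η := by
      rw [abs_lt]
      constructor <;> linarith [hx.1, hx.2, hx'.1, hx'.2]
    linarith
  have hshift : ∀ i : (_ : ℕ) × ℕ, Continuous fun β => f (frac i + β) := fun i => by fun_prop
  rw [intervalIntegral.integral_finsetSum fun i _ => (hshift i).intervalIntegrable _ _]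
  simp only [h2]
  rw [← MeasureTheory.integral_biUnion_finset _ (fun _ _ => measurableSet_Ioc) hdisj
    (fun _ _ => hint _ _), h1, intervalIntegral.integral_of_le (by linarith)]
  refine MeasureTheory.setIntegral_mono_set (hint _ _) (Filter.Eventually.of_forall hf0) ?_
  refine LE.le.eventuallyLE (Set.iUnion₂_subset fun i hi => ?_)
  obtain ⟨hi1, hi2, -⟩ := mem_fareyPairs.1 hi
  rw [mem_Icc] at hi1
  have hq : (1 : ℝ) ≤ i.1 := by exact_mod_cast hi1.1
  have hqQ : (i.1 : ℝ) ≤ Q := by exact_mod_cast hi1.2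
  have hr : (i.2 : ℝ) + 1 ≤ i.1 := by exact_mod_cast hi2
  have h6 : 0 ≤ frac i := by unfold frac; positivity
  have h7 : frac i ≤ 1 - 2 * η := by
    have a1 : frac i ≤ 1 - 1 / i.1 := by
      rw [frac, div_le_iff₀ (by linarith), sub_mul, one_mul, one_div_mul_cancel (by linarith)]
      linarith
    have a2 : 1 / (Q : ℝ) ^ 2 ≤ 1 / i.1 := by
      apply one_div_le_one_div_of_le (by linarith)
      nlinarith
    linarith
  exact Set.Ioc_subset_Ioc (by linarith) (by linarith)

/-- The lower bound `N` on a proportion of the points `frac i + β`, integrated over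
`|β| ≤ 1 / (16M)`. -/
lemma moment_ge_of_large {s : ℝ} (hs0 : 0 < s) {M N Q : ℕ} (hQ : 1 ≤ Q)
    (hQN : 10 ^ 15 * Q ≤ N) (hNM : N ^ 2 ≤ M) (hMN : M < (N + 1) ^ 2) {X : ℝ} (hX : ⌊X⌋₊ = M) :
    (Q : ℝ) ^ 2 / (256 * M) * (N : ℝ) ^ s ≤ ∫ α in (0 : ℝ)..1, ‖divisorExpSum α X‖ ^ s := by
  have hM : 1 ≤ M := le_trans (Nat.one_le_pow _ _ (by omega)) hNM
  have hM' : (0 : ℝ) < M := by exact_mod_cast hM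
  have hQ' : (0 : ℝ) < Q := by exact_mod_cast hQ
  set f : ℝ → ℝ := fun x => ‖divisorExpSum x X‖ ^ s with hf
  have hcont : Continuous f :=
    (continuous_divisorExpSum X).norm.rpow_const fun _ => Or.inr hs0.le
  have hf0 : ∀ x, 0 ≤ f x := fun x => Real.rpow_nonneg (norm_nonneg _) _
  have hper : Function.Periodic f 1 := fun x => by simp only [hf, divisorExpSum_add_one]
  set η : ℝ := 1 / (16 * M) with hη
  have hη0 : 0 < η := by positivity
  have hηQ : 2 * η ≤ 1 / (Q : ℝ) ^ 2 := by
    have h1 : Q ^ 2 ≤ M := le_trans (Nat.pow_le_pow_left (by omega) 2) hNM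
    have h2 : ((Q : ℝ) ^ 2) ≤ M := by exact_mod_cast h1
    have h3 : 2 * η = 1 / (8 * M) := by
      rw [hη]
      field_simp
      norm_num
    rw [h3]
    apply one_div_le_one_div_of_le (by positivity)
    linarith
  refine le_trans ?_ (intervalIntegral_sum_frac_le hcont hf0 hper hQ hη0 hηQ)
  have h4 : ∀ β ∈ Set.Icc (-η) η, (Q : ℝ) ^ 2 / 32 * (N : ℝ) ^ s ≤
      ∑ i ∈ fareyPairs (Icc 1 Q), f (frac i + β) := by
    intro β hβ
    have hβ' : |β| ≤ 1 / (16 * M) := abs_le.2 hβ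
    calc (Q : ℝ) ^ 2 / 32 * (N : ℝ) ^ s
        ≤ #{i ∈ fareyPairs (Icc 1 Q) | (N : ℝ) ≤ ‖divisorExpSum (frac i + β) X‖} *
            (N : ℝ) ^ s := by
          gcongr
          exact card_large_values_ge hQ hQN hNM hMN hX hβ'
      _ = ∑ i ∈ fareyPairs (Icc 1 Q) with (N : ℝ) ≤ ‖divisorExpSum (frac i + β) X‖,
            (N : ℝ) ^ s := by rw [sum_const, nsmul_eq_mul]
      _ ≤ ∑ i ∈ fareyPairs (Icc 1 Q) with (N : ℝ) ≤ ‖divisorExpSum (frac i + β) X‖,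
            f (frac i + β) := by
          refine sum_le_sum fun i hi => ?_
          exact Real.rpow_le_rpow (Nat.cast_nonneg _) (mem_filter.1 hi).2 hs0.le
      _ ≤ ∑ i ∈ fareyPairs (Icc 1 Q), f (frac i + β) :=
          sum_le_sum_of_subset_of_nonneg (filter_subset _ _) fun _ _ _ => hf0 _
  have hsum : Continuous fun β => ∑ i ∈ fareyPairs (Icc 1 Q), f (frac i + β) := by fun_prop
  have h5 := intervalIntegral.integral_mono_on (μ := MeasureTheory.volume) (by linarith)
    intervalIntegrable_const (hsum.intervalIntegrable (-η) η) h4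
  rw [intervalIntegral.integral_const, smul_eq_mul] at h5
  refine le_trans (le_of_eq ?_) h5
  rw [hη]
  field_simp
  ring

/-- Near `α = 0` the terms have argument at most `π / 8`, so the sum is at least `1 / 2`. -/
lemma moment_ge_of_small {s : ℝ} (hs0 : 0 < s) (hs1 : s < 1) {M : ℕ} (hM : 1 ≤ M) {X : ℝ}
    (hX : ⌊X⌋₊ = M) : 1 / (32 * M : ℝ) ≤ ∫ α in (0 : ℝ)..1, ‖divisorExpSum α X‖ ^ s := by
  have hM' : (1 : ℝ) ≤ M := by exact_mod_cast hM
  have hcont : Continuous fun x => ‖divisorExpSum x X‖ ^ s :=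
    (continuous_divisorExpSum X).norm.rpow_const fun _ => Or.inr hs0.le
  set η : ℝ := 1 / (16 * M) with hη
  have hη0 : 0 < η := by positivity
  have hη1 : η ≤ 1 := by
    rw [hη, div_le_one (by positivity)]
    linarith
  have h1 : ∀ x ∈ Set.Icc 0 η, (1 / 2 : ℝ) ≤ ‖divisorExpSum x X‖ ^ s := by
    intro x hx
    have hx' : |x| ≤ 1 / (16 * M) := by rw [abs_of_nonneg hx.1]; exact hx.2
    have h2 : (1 / 2 : ℝ) ≤ ‖divisorExpSum x X‖ := by
      refine le_trans ?_ (Complex.re_le_norm _)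
      rw [divisorExpSum, hX, Complex.re_sum]
      have hterm : ∀ n ∈ Icc 1 M, (1 / 2 : ℝ) ≤
          ((#n.divisors : ℂ) * addChar (n * x)).re := by
        intro n hn
        rw [mem_Icc] at hn
        have hc := half_le_re_addChar (abs_nat_mul_le hM hn.2 hx')
        have hd : (1 : ℝ) ≤ #n.divisors := by
          exact_mod_cast card_pos.2 ⟨1, Nat.one_mem_divisors.2 (by omega)⟩
        rw [← Complex.ofReal_natCast, Complex.re_ofReal_mul]
        nlinarith
      refine (hterm 1 (mem_Icc.2 ⟨le_rfl, hM⟩)).trans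
        (single_le_sum (f := fun n : ℕ => ((#n.divisors : ℂ) * addChar (n * x)).re)
          (fun n hn => ?_) (mem_Icc.2 ⟨le_rfl, hM⟩))
      linarith [hterm n hn]
    calc (1 / 2 : ℝ) ≤ (1 / 2 : ℝ) ^ s :=
          Real.self_le_rpow_of_le_one (by norm_num) (by norm_num) hs1.le
      _ ≤ _ := Real.rpow_le_rpow (by norm_num) h2 hs0.le
  calc 1 / (32 * M : ℝ) = ∫ _ in (0 : ℝ)..η, (1 / 2 : ℝ) := by
        rw [intervalIntegral.integral_const, smul_eq_mul, hη]
        field_simp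
        norm_num
    _ ≤ ∫ x in (0 : ℝ)..η, ‖divisorExpSum x X‖ ^ s :=
        intervalIntegral.integral_mono_on hη0.le intervalIntegrable_const
          (hcont.intervalIntegrable _ _) h1
    _ ≤ ∫ x in (0 : ℝ)..1, ‖divisorExpSum x X‖ ^ s := by
        refine intervalIntegral.integral_mono_interval le_rfl hη0.le hη1
          (Filter.Eventually.of_forall fun x => Real.rpow_nonneg (norm_nonneg _) _)
          (hcont.intervalIntegrable _ _)

theorem mainTheorem5 (s : ℝ) (hs0 : 0 < s) (hs1 : s < 1) :
    ∃ C : ℝ, 0 < C ∧ ∀ X : ℝ, 1 ≤ X →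
      X ^ (s / 2) ≤ C * ∫ α in (0 : ℝ)..1, ‖divisorExpSum α X‖ ^ s := by
  refine ⟨10 ^ 70, by norm_num, fun X hX => ?_⟩
  set M := ⌊X⌋₊ with hMdef
  have hM : 1 ≤ M := Nat.one_le_floor_iff X |>.2 hX
  have hM' : (1 : ℝ) ≤ M := by exact_mod_cast hM
  have hXM : X < M + 1 := Nat.lt_floor_add_one X
  set N := Nat.sqrt M with hN
  have hNM : N ^ 2 ≤ M := Nat.sqrt_le' M
  have hMN : M < (N + 1) ^ 2 := Nat.lt_succ_sqrt' M
  have hN1 : 1 ≤ N := Nat.sqrt_pos.2 hM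
  have hN1' : (1 : ℝ) ≤ N := by exact_mod_cast hN1
  have hMN' : (M : ℝ) + 1 ≤ (N + 1) ^ 2 := by exact_mod_cast hMN
  have hX2 : X ≤ (2 * N : ℝ) ^ 2 := by nlinarith
  have hXs : X ^ (s / 2) ≤ (2 * N : ℝ) ^ s := by
    calc X ^ (s / 2) ≤ ((2 * N : ℝ) ^ 2) ^ (s / 2) :=
          Real.rpow_le_rpow (by linarith) hX2 (by linarith)
      _ = (2 * N : ℝ) ^ s := by
          rw [← Real.rpow_natCast, ← Real.rpow_mul (by positivity)]
          congr 1
          push_cast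
          ring
  -- Below the threshold needed for `1 ≤ Q`, `X` is bounded and the arc around `0` suffices.
  rcases lt_or_ge N (10 ^ 15) with hlt | hge
  · have h1 := moment_ge_of_small hs0 hs1 hM hMdef.symm
    have hNr : (N : ℝ) ≤ 10 ^ 15 := by exact_mod_cast hlt.le
    have h2 : X ^ (s / 2) ≤ 2 * N :=
      hXs.trans (Real.rpow_le_self_of_one_le (by linarith) hs1.le)
    have h3 : (M : ℝ) ≤ 4 * 10 ^ 30 := by nlinarith
    have h4 : 1 / (32 * (4 * 10 ^ 30)) ≤ 1 / (32 * M : ℝ) := by gcongr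
    have h5 := h4.trans h1
    calc X ^ (s / 2) ≤ 2 * 10 ^ 15 := by linarith
      _ ≤ 10 ^ 70 * (1 / (32 * (4 * 10 ^ 30))) := by norm_num
      _ ≤ _ := by gcongr
  · set Q := N / 10 ^ 15 with hQdef
    have hQ : 1 ≤ Q := (Nat.one_le_div_iff (by norm_num)).2 hge
    have hQN : 10 ^ 15 * Q ≤ N := Nat.mul_div_le N _
    have hNQ : (N : ℝ) ≤ 2 * 10 ^ 15 * Q := by
      have : N < 10 ^ 15 * (Q + 1) := Nat.lt_mul_div_succ N (by norm_num)
      have h' : N ≤ 2 * 10 ^ 15 * Q := by nlinarith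
      exact_mod_cast h'
    have h1 := moment_ge_of_large hs0 hQ hQN hNM hMN hMdef.symm
    have hNs : 0 ≤ (N : ℝ) ^ s := by positivity
    have h2 : X ^ (s / 2) ≤ 2 * (N : ℝ) ^ s := by
      refine hXs.trans ?_
      rw [Real.mul_rpow (by norm_num) (by positivity)]
      gcongr
      exact Real.rpow_le_self_of_one_le (by norm_num) hs1.le
    have h3 : 1 / (10 ^ 34 * 4) ≤ (Q : ℝ) ^ 2 / (256 * M) := by
      have a1 : (M : ℝ) ≤ 4 * (N : ℝ) ^ 2 := by nlinarith
      have a2 : (N : ℝ) ^ 2 ≤ (2 * 10 ^ 15 * Q) ^ 2 := by gcongr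
      rw [div_le_div_iff₀ (by norm_num) (by positivity)]
      nlinarith
    calc X ^ (s / 2) ≤ 2 * (N : ℝ) ^ s := h2
      _ ≤ 10 ^ 70 * (1 / (10 ^ 34 * 4) * (N : ℝ) ^ s) := by
          have : (2 : ℝ) ≤ 10 ^ 70 * (1 / (10 ^ 34 * 4)) := by norm_num
          calc 2 * (N : ℝ) ^ s ≤ 10 ^ 70 * (1 / (10 ^ 34 * 4)) * (N : ℝ) ^ s := by gcongr
            _ = _ := by ring
      _ ≤ 10 ^ 70 * ((Q : ℝ) ^ 2 / (256 * M) * (N : ℝ) ^ s) := by gcongr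
      _ ≤ _ := by gcongr
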